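/- Let $d\ge 1$, $\mathbb R^d_+=(0,\infty)^d$ with Lebesgue measure, and $\mathbb N=\{0,1,2,\dots\}$. For $\beta\in(-1,\infty)^d$ and $k\in\mathbb N^d$ let $$\mathcal L_k^\beta(x)=\prod_{i=1}^d\Big(\frac{\Gamma(k_i+1)}{\Gamma(k_i+\beta_i+1)}\Big)^{1/2}L_{k_i}^{\beta_i}(x_i)\,x_i^{\beta_i/2}e^{-x_i/2},\qquad x\in\mathbb R^d_+,$$ be the standard Laguerre functions, where $L_m^b$ is the Laguerre polynomial of degree $m$ and order $b$. Write $|k|=\sum_i k_i$, $|\beta|=\sum_i\beta_i$, and let $$G_t^{\beta}(x,y)=\sum_{n=0}^\infty e^{-t(n+(|\beta|+d)/2)}\sum_{|k|=n}\mathcal L_k^\beta(x)\mathcal L_k^\beta(y),\qquad t>0,\ x,y\in\mathbb R^d_+ .$$ Let $L_\beta$ be the self-adjoint operator on $L^2(\mathbb R^d_+)$ with $L_\beta\mathcal L_k^\beta=(|k|+(|\beta|+d)/2)\mathcal L_k^\beta$, $k\in\mathbb N^d$ (the standard Laguerre operator). **Proposition.** Fix $j\in\{1,\dots,d\}$ and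 $\alpha\in\mathbb R^d$ with $\alpha_j\ge-1$ and $\alpha_i\ge0$ for $i\ne j$, and let $e_j$ be the $j$th coordinate vector. Then the series for $G_t^{\alpha+e_j}(x,y)$ converges for all $t>0$ and $x,y\in\mathbb R^d_+$, and the operators $\widetilde T_0=\mathrm{Id}$ and $$\widetilde T_tf(x)=e^{-t/2}\int_{\mathbb R^d_+}G_t^{\alpha+e_j}(x,y)f(y)\,dy,\qquad t>0,\ x\in\mathbb R^d_+,$$ are well defined on $L^1(\mathbb R^d_+)+L^\infty(\mathbb R^d_+)$ (the integral converges absolutely for every $x\in\mathbb R^d_+$). On $L^2(\mathbb R^d_+)$ they coincide with the modified Laguerre semigroup $\exp(-t(L_{\alpha+e_j}+\tfrac12))$, that is, for $f\in L^2(\mathbb R^d_+)$ and $t\ge 0$, with convergence in $L^2$, $$\widetilde T_tf=\sum_{n=0}^\infty e^{-t(n+(|\alpha+e_j|+d)/2+1/2)}\sum_{|k|=n}\langle f,\mathcal L_k^{\alpha+e_j}\rangle\,\mathcal L_k^{\alpha+e_j}.$$ The family $\{\widetilde T_t\}_{t\ge0}$ is a submarkovian symmetric diffusion semigroup with domain $L^1+L^\infty$: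 the $\widetilde T_t$ are linear operators from $L^1+L^\infty$ to the measurable functions, $\widetilde T_0=\mathrm{Id}$; for each $1\le p\le\infty$ every $\widetilde T_t$ is a contraction on $L^p$ and $\{\widetilde T_t\}$ is a semigroup there; every $\widetilde T_t$ is self-adjoint on $L^2$; $\widetilde T_tf\to f$ in $L^2$ as $t\to0^+$ for each $f\in L^2$; $\widetilde T_tf\ge0$ whenever $f\ge0$; and $\widetilde T_t\mathbf 1\le\mathbf 1$ for all $t\ge0$. It is not Markovian, i.e. it is not true that $\widetilde T_t\mathbf 1=\mathbf 1$ for all $t$. Moreover, for every $1\le p\le\infty$, $$\|\widetilde T_t\|_{p\to p}\le e^{-t/2}\big(\cosh(t/2)\big)^{-d},\qquad t>0.$$ Scalars may be real or complex. -/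

import Mathlib

open MeasureTheory Filter Topology
open scoped ENNReal NNReal ComplexOrder

noncomputable section

/-! ### Symmetric diffusion semigroups

Operators act on (representatives of) classes of measurable functions; a domain `D` is a linear
space of a.e. strongly measurable functions, and all identities are meant almost everywhere. -/

section Abstract

variable {X 𝕜 : Type*} [MeasurableSpace X] [RCLike 𝕜]

/-- The space `L¹ + L^∞`. -/
def LOneAddLInfty (𝕜 : Type*) [RCLike 𝕜] (μ : Measure X) : Submodule 𝕜 (X → 𝕜) where
  carrier := {f | ∃ g h : X → 𝕜, MemLp g 1 μ ∧ MemLp h ∞ μ ∧ f = g + h}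
  zero_mem' := ⟨0, 0, MemLp.zero, MemLp.zero, by simp⟩
  add_mem' := by
    rintro _ _ ⟨g, h, hg, hh, rfl⟩ ⟨g', h', hg', hh', rfl⟩
    exact ⟨g + g', h + h', hg.add hg', hh.add hh', by abel⟩
  smul_mem' := by
    rintro c _ ⟨g, h, hg, hh, rfl⟩
    exact ⟨c • g, c • h, hg.const_smul c, hh.const_smul c, by simp⟩

/-- The operator norm `‖A‖_{p → p}`, the supremum of `‖A f‖_p` over the unit ball of `L^p`. -/
def lpOpNorm (μ : Measure X) (p : ℝ≥0∞) (A : (X → 𝕜) → (X → 𝕜)) : ℝ≥0∞ :=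
  ⨆ f : {f : X → 𝕜 // MemLp f p μ ∧ eLpNorm f p μ ≤ 1}, eLpNorm (A f) p μ

/-- A symmetric diffusion semigroup `(T_t)_{t ≥ 0}` with domain `D`. -/
structure IsSymmetricDiffusionSemigroup (μ : Measure X) (D : Submodule 𝕜 (X → 𝕜))
    (T : ℝ≥0 → (X → 𝕜) → (X → 𝕜)) : Prop where
  /-- `D` consists of measurable functions. -/
  measurable_of_mem : ∀ f ∈ D, AEStronglyMeasurable f μ
  /-- `D` contains all the `L^p` spaces. -/
  mem_of_memLp : ∀ p : ℝ≥0∞, 1 ≤ p → ∀ f : X → 𝕜, MemLp f p μ → f ∈ D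
  /-- `T_t` maps `D` into the measurable functions. -/
  measurable_map : ∀ t, ∀ f ∈ D, AEStronglyMeasurable (T t f) μ
  /-- `T_t` is well defined on classes of a.e. equal functions. -/
  congr : ∀ t, ∀ f ∈ D, ∀ g ∈ D, f =ᵐ[μ] g → T t f =ᵐ[μ] T t g
  /-- `T_t` is additive. -/
  map_add : ∀ t, ∀ f ∈ D, ∀ g ∈ D, T t (f + g) =ᵐ[μ] T t f + T t g
  /-- `T_t` is homogeneous. -/
  map_smul : ∀ t, ∀ c : 𝕜, ∀ f ∈ D, T t (c • f) =ᵐ[μ] c • T t f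
  /-- `T_0` is the identity. -/
  zero : ∀ f ∈ D, T 0 f =ᵐ[μ] f
  /-- `T_t` maps each `L^p` into itself. -/
  memLp : ∀ p : ℝ≥0∞, 1 ≤ p → ∀ t, ∀ f : X → 𝕜, MemLp f p μ → MemLp (T t f) p μ
  /-- `T_t` is a contraction on each `L^p`. -/
  contraction : ∀ p : ℝ≥0∞, 1 ≤ p → ∀ t, lpOpNorm μ p (T t) ≤ 1
  /-- The semigroup property on each `L^p`. -/
  semigroup : ∀ p : ℝ≥0∞, 1 ≤ p → ∀ s t, ∀ f : X → 𝕜, MemLp f p μ →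
    T (s + t) f =ᵐ[μ] T s (T t f)
  /-- `T_t` is self-adjoint on `L²` (it is bounded and everywhere defined there). -/
  selfAdjoint : ∀ t, ∀ f g : X → 𝕜, MemLp f 2 μ → MemLp g 2 μ →
    ∫ x, inner 𝕜 (T t f x) (g x) ∂μ = ∫ x, inner 𝕜 (f x) (T t g x) ∂μ
  /-- Strong continuity at `0` on `L²`. -/
  tendsto : ∀ f : X → 𝕜, MemLp f 2 μ →
    Tendsto (fun t : ℝ≥0 => eLpNorm (T t f - f) 2 μ) (𝓝[>] 0) (𝓝 0)

/-- Positivity; for complex scalars, `0 ≤ z` means that `z` is real and nonnegative. -/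
def IsPositivityPreserving (μ : Measure X) (D : Submodule 𝕜 (X → 𝕜))
    (T : ℝ≥0 → (X → 𝕜) → (X → 𝕜)) : Prop :=
  ∀ t, ∀ f ∈ D, (∀ᵐ x ∂μ, 0 ≤ f x) → ∀ᵐ x ∂μ, 0 ≤ T t f x

/-- A Markovian symmetric diffusion semigroup: positive, and `T_t 1 = 1` for all `t`. -/
def IsMarkovian (μ : Measure X) (D : Submodule 𝕜 (X → 𝕜))
    (T : ℝ≥0 → (X → 𝕜) → (X → 𝕜)) : Prop :=
  IsSymmetricDiffusionSemigroup μ D T ∧ IsPositivityPreserving μ D T ∧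
    ∀ t, ∀ᵐ x ∂μ, T t (fun _ => 1) x = 1

/-- A submarkovian symmetric diffusion semigroup: positive, and `T_t 1 ≤ 1` for all `t`. -/
def IsSubmarkovian (μ : Measure X) (D : Submodule 𝕜 (X → 𝕜))
    (T : ℝ≥0 → (X → 𝕜) → (X → 𝕜)) : Prop :=
  IsSymmetricDiffusionSemigroup μ D T ∧ IsPositivityPreserving μ D T ∧
    ∀ t, ∀ᵐ x ∂μ, T t (fun _ => 1) x ≤ 1

end Abstract

/-! ### Standard Laguerre functions -/

/-- The Laguerre polynomial of degree `k` and order `a > -1`,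
`L_k^a(x) = ∑_{i ≤ k} Γ(k+a+1) / Γ(i+a+1) * (-x)^i / (i! (k-i)!)`. -/
def laguerrePoly (a : ℝ) (k : ℕ) (x : ℝ) : ℝ :=
  ∑ i ∈ Finset.range (k + 1), Real.Gamma (k + a + 1) / Real.Gamma (i + a + 1) *
    ((-x) ^ i / ((i.factorial : ℝ) * ((k - i).factorial : ℝ)))

/-- The one-dimensional standard Laguerre function of order `a > -1` on `(0, ∞)`. -/
def laguerreFun (a : ℝ) (k : ℕ) (x : ℝ) : ℝ :=
  Real.sqrt (Real.Gamma (k + 1) / Real.Gamma (k + a + 1)) * laguerrePoly a k x *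
    x ^ (a / 2) * Real.exp (-x / 2)

/-- The multi-dimensional standard Laguerre functions are tensor products. -/
def laguerreFunPi {d : ℕ} (a : Fin d → ℝ) (k : Fin d → ℕ) (x : Fin d → ℝ) : ℝ :=
  ∏ i, laguerreFun (a i) (k i) (x i)

/-- The open positive orthant in `ℝ^d`. -/
def posOrthant (d : ℕ) : Set (Fin d → ℝ) := {x | ∀ i, 0 < x i}

/-- Lebesgue measure on the open positive orthant. -/
def orthantVolume (d : ℕ) : Measure (Fin d → ℝ) := volume.restrict (posOrthant d)

/-- The eigenvalue `n + (|a| + d) / 2` of the standard Laguerre operator that belongs to the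
Laguerre functions with multi-index of length `n`. -/
def laguerreEigenvalue {d : ℕ} (a : Fin d → ℝ) (n : ℕ) : ℝ := n + ((∑ i, a i) + d) / 2

/-- The `n`-th term of the series of the heat kernel at time `t`. -/
def laguerreKernelTerm {d : ℕ} (a : Fin d → ℝ) (t : ℝ) (x y : Fin d → ℝ) (n : ℕ) : ℝ :=
  Real.exp (-t * laguerreEigenvalue a n) *
    ∑ k ∈ Finset.piAntidiag Finset.univ n, laguerreFunPi a k x * laguerreFunPi a k y

/-- The heat kernel of the standard Laguerre semigroup of order `a`. -/
def laguerreKernel {d : ℕ} (a : Fin d → ℝ) (t : ℝ) (x y : Fin d → ℝ) : ℝ :=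
  ∑' n, laguerreKernelTerm a t x y n

/-! ### The modified standard Laguerre semigroup -/

section Modified

variable {𝕜 : Type*} [RCLike 𝕜] {d : ℕ}

/-- The shifted order `α + e_j`. -/
def shiftOrder (α : Fin d → ℝ) (j : Fin d) : Fin d → ℝ := α + Pi.single j 1

/-- The spectral definition of the modified semigroup on `L²`: the `N`-th partial sum (multi-indices
of length `n < N`) of the expansion of `exp(-t (L + 1/2)) f`, where `L` is the self-adjoint
Laguerre operator of order `α + e_j`. -/
def modifiedSpectralPartialSum (α : Fin d → ℝ) (j : Fin d) (t : ℝ≥0) (f : (Fin d → ℝ) → 𝕜)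
    (N : ℕ) : (Fin d → ℝ) → 𝕜 := fun x =>
  ∑ n ∈ Finset.range N, Real.exp (-(t : ℝ) * (laguerreEigenvalue (shiftOrder α j) n + 1 / 2)) •
    ∑ k ∈ Finset.piAntidiag Finset.univ n, laguerreFunPi (shiftOrder α j) k x •
      ∫ y, laguerreFunPi (shiftOrder α j) k y • f y ∂(orthantVolume d)

/-- The modified semigroup on `L¹ + L^∞`: the identity for `t = 0`, and the integral operator with
kernel `exp(-t/2) G_t^{α + e_j}(x, y)` for `t > 0`. -/
def modifiedLaguerre (α : Fin d → ℝ) (j : Fin d) (t : ℝ≥0) (f : (Fin d → ℝ) → 𝕜) :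
    (Fin d → ℝ) → 𝕜 :=
  if t = 0 then f
  else fun x => Real.exp (-(t : ℝ) / 2) •
    ∫ y, laguerreKernel (shiftOrder α j) t x y • f y ∂(orthantVolume d)

end Modified

end

/-! ### Gamma function estimates -/

/-! Put β = α + e_j; the hypotheses say exactly that all β_i ≥ 0. Everything rests on the
Hille-Hardy closed form of the heat kernel, a product over the coordinates of an explicit positive
function built from the modified Bessel series.

The closed form is not obtained by summing the Laguerre series. It is taken as the definition of an
integral operator, and the Laguerre functions are shown to be its eigenfunctions: the operator is
triangular on weighted monomials (`integral_hilleHardyKernel_mul_laguerreMonomial`), and a binomial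
identity diagonalises it on Laguerre functions. These are orthonormal, by finite differences of
Gamma ratios, and complete, because a density with exponential decay is determined by its moments
(`ae_eq_zero_of_forall_moment_eq_zero`). Parseval for two kernel sections at times s and t then
gives absolute convergence of the bilinear series at time s + t, and the L² expansion of one section
identifies the sum with the closed form for almost every y (`laguerreKernel_ae_eq`). That suffices
for all statements about the operators. The semigroup law comes from the same Parseval identity, the
spectral formula and strong continuity from the diagonal action on coefficients.

The norm bound is a row-integral estimate. In one dimension, with r = exp(-t), termwise integration,
the log-convexity inequality Γ(m+b/2+1)² ≤ m! Γ(m+b+1) and the bound ∑ s^(m+a)/Γ(m+a+1) ≤ e^s for a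
≥ 0 give at most 2√r/(1+r) = 1/cosh(t/2) (`integral_hilleHardyKernel_le`). Tensorising and
multiplying by exp(-t/2) gives the stated constant, and the Schur test carries it to every L^p,
since the kernel is symmetric and nonnegative. The constant is strictly below 1 for t > 0, which
yields contractivity and the submarkovian property and excludes the Markovian one. -/

theorem Gamma_natCast_add_add_one_succ {b : ℝ} (hb : 0 ≤ b) (m : ℕ) :
    Real.Gamma ((m + 1 : ℕ) + b + 1) = (m + b + 1) * Real.Gamma (m + b + 1) := by
  have h : (m : ℝ) + b + 1 ≠ 0 := by positivity
  rw [← Real.Gamma_add_one h]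
  congr 1
  push_cast
  ring

theorem Gamma_natCast_add_add_one_pos {b : ℝ} (hb : 0 ≤ b) (m : ℕ) :
    0 < Real.Gamma (m + b + 1) := Real.Gamma_pos_of_pos (by positivity)

/-- Factor by factor, m + 1 ≤ m + b + 1. This reduces the Bessel series to exponential series. -/
theorem factorial_mul_Gamma_le {b : ℝ} (hb : 0 ≤ b) (m : ℕ) :
    m.factorial * Real.Gamma (b + 1) ≤ Real.Gamma (m + b + 1) := by
  induction m with
  | zero => simp
  | succ m ih =>
    rw [Gamma_natCast_add_add_one_succ hb, Nat.factorial_succ]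
    push_cast
    have h1 := Gamma_natCast_add_add_one_pos hb m
    calc ((m : ℝ) + 1) * m.factorial * Real.Gamma (b + 1)
        = (m + 1) * (m.factorial * Real.Gamma (b + 1)) := by ring
      _ ≤ (m + 1) * Real.Gamma (m + b + 1) := by gcongr
      _ ≤ (m + b + 1) * Real.Gamma (m + b + 1) := by gcongr; linarith

theorem Real.hasSum_pow_div_factorial (z : ℝ) :
    HasSum (fun m : ℕ => z ^ m / m.factorial) (Real.exp z) := by
  rw [Real.exp_eq_exp_ℝ]
  exact NormedSpace.expSeries_div_hasSum_exp z

/-- Log-convexity of the Gamma function at a midpoint. -/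
theorem Gamma_add_half_sq_le {b : ℝ} (hb : 0 ≤ b) (m : ℕ) :
    Real.Gamma (m + b / 2 + 1) ^ 2 ≤ m.factorial * Real.Gamma (m + b + 1) := by
  have h := Real.Gamma_mul_add_mul_le_rpow_Gamma_mul_rpow_Gamma (s := m + 1) (t := m + b + 1)
    (a := 1 / 2) (b := 1 / 2) (by positivity) (by positivity) (by norm_num) (by norm_num)
    (by norm_num)
  have h1 := Gamma_natCast_add_add_one_pos hb m
  have h2 : 0 < Real.Gamma (m + 1) := Real.Gamma_pos_of_pos (by positivity)
  have e : (1 / 2 : ℝ) * (m + 1) + 1 / 2 * (m + b + 1) = m + b / 2 + 1 := by ring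
  rw [e, ← Real.sqrt_eq_rpow, ← Real.sqrt_eq_rpow] at h
  have h3 : 0 ≤ Real.Gamma (m + b / 2 + 1) := (Real.Gamma_pos_of_pos (by positivity)).le
  calc Real.Gamma (m + b / 2 + 1) ^ 2
      ≤ (√(Real.Gamma (m + 1)) * √(Real.Gamma (m + b + 1))) ^ 2 := by gcongr
    _ = m.factorial * Real.Gamma (m + b + 1) := by
      rw [mul_pow, Real.sq_sqrt h2.le, Real.sq_sqrt h1.le, Real.Gamma_nat_eq_factorial]

theorem integrableOn_rpow_mul_exp_neg_mul {c p : ℝ} (hc : -1 < c) (hp : 0 < p) :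
    IntegrableOn (fun u => u ^ c * Real.exp (-(p * u))) (Set.Ioi 0) := by
  have := integrableOn_rpow_mul_exp_neg_mul_rpow (p := 1) hc one_pos hp
  simpa using this

/-- Recursion for the upper incomplete Gamma function. -/
theorem integral_Ioi_rpow_mul_exp_neg {c s : ℝ} (hc : 0 < c) (hs : 0 ≤ s) :
    ∫ u in Set.Ioi s, u ^ c * Real.exp (-u) =
      c * (∫ u in Set.Ioi s, u ^ (c - 1) * Real.exp (-u)) + s ^ c * Real.exp (-s) := by
  have i1 : IntegrableOn (fun u => u ^ c * Real.exp (-u)) (Set.Ioi s) := by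
    have := integrableOn_rpow_mul_exp_neg_mul (c := c) (p := 1) (by linarith) one_pos
    simp only [one_mul] at this
    exact this.mono_set (Set.Ioi_subset_Ioi hs)
  have i2 : IntegrableOn (fun u => u ^ (c - 1) * Real.exp (-u)) (Set.Ioi s) := by
    have := integrableOn_rpow_mul_exp_neg_mul (c := c - 1) (p := 1) (by linarith) one_pos
    simp only [one_mul] at this
    exact this.mono_set (Set.Ioi_subset_Ioi hs)
  have key := integral_Ioi_of_hasDerivAt_of_tendsto (a := s) (m := 0)
    (f := fun u => u ^ c * Real.exp (-u))
    (f' := fun u => c * (u ^ (c - 1) * Real.exp (-u)) - u ^ c * Real.exp (-u)) ?_ ?_ ?_ ?_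
  · rw [integral_sub (i2.const_mul c) i1, integral_const_mul] at key
    linarith
  · exact ((Real.continuous_rpow_const hc.le).mul
      (Real.continuous_exp.comp continuous_neg)).continuousWithinAt
  · intro u hu
    have hu' : u ≠ 0 := (hs.trans_lt hu).ne'
    have h1 := Real.hasDerivAt_rpow_const (x := u) (p := c) (Or.inl hu')
    have h2 := (hasDerivAt_neg u).exp
    exact (h1.mul h2).congr_deriv (by ring)
  · exact (i2.const_mul c).sub i1
  · simpa using tendsto_rpow_mul_exp_neg_mul_atTop_nhds_zero c 1 one_pos

/-- Partial sums of a fractional exponential series are dominated by the exponential. -/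
theorem sum_rpow_div_Gamma_le_exp {a s : ℝ} (ha : 0 ≤ a) (hs : 0 ≤ s) (N : ℕ) :
    ∑ m ∈ Finset.range N, s ^ (m + a) / Real.Gamma (m + a + 1) ≤ Real.exp s := by
  -- The case a = 0 is the exponential series itself. It is kept apart because the quotient below
  -- involves Γ(a) at m = 0.
  rcases ha.eq_or_lt with rfl | ha
  · have := sum_le_hasSum (Finset.range N) (fun m _ => by positivity)
      (Real.hasSum_pow_div_factorial s)
    simpa [Real.Gamma_nat_eq_factorial] using this
  -- The regularised upper incomplete Gamma function Γ(m+a, s)/Γ(m+a). By its recursion, the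
  -- summands times e^(-s) are its increments. Since U 0 ≥ 0 and U N ≤ 1, the telescoped sum is at
  -- most 1.
  set U : ℕ → ℝ := fun m =>
    (∫ u in Set.Ioi s, u ^ (m + a - 1) * Real.exp (-u)) / Real.Gamma (m + a) with hU
  have step : ∀ m : ℕ, U (m + 1) - U m =
      s ^ (m + a) / Real.Gamma (m + a + 1) * Real.exp (-s) := by
    intro m
    have hc : (0 : ℝ) < m + a := by positivity
    have hG := Real.Gamma_pos_of_pos hc
    have := integral_Ioi_rpow_mul_exp_neg hc hs
    simp only [hU]
    have e1 : ((m + 1 : ℕ) : ℝ) + a - 1 = m + a := by push_cast; ring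
    have e2 : ((m + 1 : ℕ) : ℝ) + a = m + a + 1 := by push_cast; ring
    rw [e1, e2, this, Real.Gamma_add_one hc.ne']
    field_simp
    ring
  have hU0 : 0 ≤ U 0 := by
    refine div_nonneg (setIntegral_nonneg measurableSet_Ioi fun u hu => ?_)
      (Real.Gamma_pos_of_pos (by simpa using ha)).le
    have : 0 ≤ u := hs.trans (le_of_lt hu)
    positivity
  have hUN : U N ≤ 1 := by
    have hc : (0 : ℝ) < N + a := by positivity
    have hG := Real.Gamma_pos_of_pos hc
    rw [div_le_one hG, Real.Gamma_eq_integral hc]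
    have i := integrableOn_rpow_mul_exp_neg_mul (c := N + a - 1) (p := 1) (by linarith) one_pos
    simp only [one_mul] at i
    have e : (∫ x in Set.Ioi (0 : ℝ), Real.exp (-x) * x ^ ((N : ℝ) + a - 1)) =
        ∫ x in Set.Ioi (0 : ℝ), x ^ ((N : ℝ) + a - 1) * Real.exp (-x) := by
      simp only [mul_comm]
    rw [e]
    refine setIntegral_mono_set i ?_ (Set.Ioi_subset_Ioi hs).eventuallyLE
    filter_upwards [ae_restrict_mem measurableSet_Ioi] with u hu
    have : (0 : ℝ) ≤ u := le_of_lt hu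
    simp only [Pi.zero_apply]
    positivity
  have tel : (∑ m ∈ Finset.range N, s ^ (m + a) / Real.Gamma (m + a + 1)) * Real.exp (-s) =
      U N - U 0 := by
    rw [Finset.sum_mul, ← Finset.sum_range_sub]
    exact Finset.sum_congr rfl fun m _ => (step m).symm
  have : (∑ m ∈ Finset.range N, s ^ (m + a) / Real.Gamma (m + a + 1)) * Real.exp (-s) ≤ 1 := by
    rw [tel]; linarith
  rwa [Real.exp_neg, ← div_eq_mul_inv, div_le_one (Real.exp_pos s)] at this

/-! ### The Bessel series -/

/-- The series `∑ z^m / (m! Γ(m+b+1))`, an entire function of `z` that is a normalised modified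
Bessel function of order `b`. -/
noncomputable def besselSeries (b z : ℝ) : ℝ :=
  ∑' m : ℕ, z ^ m / (m.factorial * Real.Gamma (m + b + 1))

theorem norm_besselSeries_term_le {b : ℝ} (hb : 0 ≤ b) (z : ℝ) (m : ℕ) :
    ‖z ^ m / (m.factorial * Real.Gamma (m + b + 1))‖ ≤
      |z| ^ m / m.factorial / Real.Gamma (b + 1) := by
  have h1 := factorial_mul_Gamma_le hb m
  have h0 : 0 < Real.Gamma (b + 1) := Real.Gamma_pos_of_pos (by positivity)
  have h2 : Real.Gamma (b + 1) ≤ Real.Gamma (m + b + 1) := by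
    refine le_trans ?_ h1
    exact le_mul_of_one_le_left h0.le (by exact_mod_cast m.factorial_pos)
  have h3 := Gamma_natCast_add_add_one_pos hb m
  rw [norm_div, norm_mul, norm_pow, Real.norm_eq_abs, Real.norm_of_nonneg h3.le,
    Real.norm_natCast, div_div]
  gcongr

theorem summable_besselSeries {b : ℝ} (hb : 0 ≤ b) (z : ℝ) :
    Summable fun m : ℕ => z ^ m / (m.factorial * Real.Gamma (m + b + 1)) :=
  Summable.of_norm_bounded ((Real.hasSum_pow_div_factorial |z|).summable.div_const _)
    (norm_besselSeries_term_le hb z)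

theorem besselSeries_nonneg {b z : ℝ} (hb : 0 ≤ b) (hz : 0 ≤ z) : 0 ≤ besselSeries b z :=
  tsum_nonneg fun m => by
    have := Gamma_natCast_add_add_one_pos hb m
    positivity

/-- Since m! Γ(m+b+1) ≥ m!² Γ(b+1), each term is at most (u^m/m!)(v^m/m!)/Γ(b+1), and v^m/m! ≤ e^v.
The factorised form is what lets the kernel be dominated by a tensor product. -/
theorem besselSeries_mul_le {b u v : ℝ} (hb : 0 ≤ b) (hu : 0 ≤ u) (hv : 0 ≤ v) :
    besselSeries b (u * v) ≤ Real.exp u * Real.exp v / Real.Gamma (b + 1) := by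
  have h0 : 0 < Real.Gamma (b + 1) := Real.Gamma_pos_of_pos (by positivity)
  refine (summable_besselSeries hb _).tsum_le_of_sum_le ?_
  intro s
  have hs := ((Real.hasSum_pow_div_factorial u).mul_right (Real.exp v)).div_const
    (Real.Gamma (b + 1))
  refine le_trans (Finset.sum_le_sum fun m _ => ?_)
    (sum_le_hasSum s (fun m _ => by positivity) hs)
  have h1 := factorial_mul_Gamma_le hb m
  have h2 := Gamma_natCast_add_add_one_pos hb m
  calc (u * v) ^ m / (m.factorial * Real.Gamma (m + b + 1))
      ≤ (u * v) ^ m / (m.factorial * (m.factorial * Real.Gamma (b + 1))) := by gcongr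
    _ = u ^ m / m.factorial * (v ^ m / m.factorial) / Real.Gamma (b + 1) := by
      rw [mul_pow]; field_simp
    _ ≤ u ^ m / m.factorial * Real.exp v / Real.Gamma (b + 1) := by
      gcongr
      exact Real.pow_div_factorial_le_exp v hv m

theorem measurable_besselSeries {b : ℝ} (hb : 0 ≤ b) : Measurable (besselSeries b) := by
  refine measurable_of_tendsto_metrizable
    (f := fun N z => ∑ m ∈ Finset.range N, z ^ m / (m.factorial * Real.Gamma (m + b + 1)))
    (fun N => by fun_prop) (tendsto_pi_nhds.2 fun z => ?_)
  exact (summable_besselSeries hb z).hasSum.tendsto_sum_nat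

/-- Laplace-type integrals of the Bessel series, term by term. -/
theorem integral_rpow_mul_exp_mul_besselSeries {b ρ p w S : ℝ} (hb : 0 ≤ b) (hρ : -1 < ρ)
    (hp : 0 < p) (hw : 0 ≤ w)
    (hS : HasSum (fun m : ℕ => w ^ m / (m.factorial * Real.Gamma (m + b + 1)) *
      ((1 / p) ^ (m + ρ + 1) * Real.Gamma (m + ρ + 1))) S) :
    ∫ y in Set.Ioi 0, y ^ ρ * Real.exp (-(p * y)) * besselSeries b (w * y) = S := by
  set F : ℕ → ℝ → ℝ := fun m y => w ^ m / (m.factorial * Real.Gamma (m + b + 1)) *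
    (y ^ (m + ρ) * Real.exp (-(p * y))) with hF
  have hFi : ∀ m, Integrable (F m) (volume.restrict (Set.Ioi 0)) := fun m =>
    (integrableOn_rpow_mul_exp_neg_mul (c := m + ρ)
      (by have : (0 : ℝ) ≤ m := by positivity
          linarith) hp).const_mul _
  have hFint : ∀ m, ∫ y in Set.Ioi 0, F m y = w ^ m / (m.factorial * Real.Gamma (m + b + 1)) *
      ((1 / p) ^ (m + ρ + 1) * Real.Gamma (m + ρ + 1)) := by
    intro m
    have := Real.integral_rpow_mul_exp_neg_mul_Ioi (a := m + ρ + 1) (r := p)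
      (by have : (0 : ℝ) ≤ m := by positivity
          linarith) hp
    rw [add_sub_cancel_right] at this
    simp only [hF]
    rw [integral_const_mul, this]
  have hnn : ∀ m, ∀ y ∈ Set.Ioi (0 : ℝ), 0 ≤ F m y := by
    intro m y hy
    have := Gamma_natCast_add_add_one_pos hb m
    have hy' : (0 : ℝ) ≤ y := le_of_lt hy
    simp only [hF]
    positivity
  have hnorm : ∀ m, ∫ y in Set.Ioi 0, ‖F m y‖ = ∫ y in Set.Ioi 0, F m y := fun m =>
    setIntegral_congr_fun measurableSet_Ioi fun y hy => Real.norm_of_nonneg (hnn m y hy)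
  -- All terms are nonnegative on the half line, so summability of the integrals, contained in `hS`,
  -- already justifies exchanging sum and integral.
  have h := hasSum_integral_of_summable_integral_norm hFi
    (by simp only [hnorm, hFint]; exact hS.summable)
  simp only [hFint] at h
  rw [hS.unique h]
  refine setIntegral_congr_fun measurableSet_Ioi fun y hy => ?_
  have hy' : (0 : ℝ) < y := hy
  simp only [besselSeries, hF]
  rw [← tsum_mul_left]
  refine tsum_congr fun m => ?_
  rw [Real.rpow_add hy', Real.rpow_natCast, mul_pow]
  ring

/-! ### Binomial and finite-difference identities for Gamma ratios -/

/-- A terminating case of Kummer's transformation. Induction on k with b free: the functional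
equation contributes a factor m + (k+b+1); the part with m is, after an index shift, z times the
series of order b + 1, and Pascal's rule recombines the two finite sums. -/
theorem hasSum_pow_div_factorial_mul_Gamma_ratio (k : ℕ) : ∀ {b : ℝ}, 0 ≤ b → ∀ z : ℝ,
    HasSum (fun m : ℕ => z ^ m / m.factorial * (Real.Gamma (m + k + b + 1) /
        Real.Gamma (m + b + 1)))
      (Real.exp z * ∑ i ∈ Finset.range (k + 1), k.choose i * z ^ i *
        (Real.Gamma (k + b + 1) / Real.Gamma (i + b + 1))) := by
  induction k with
  | zero =>
    intro b hb z
    have h : ∀ m : ℕ, Real.Gamma (m + b + 1) ≠ 0 := fun m =>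
      (Gamma_natCast_add_add_one_pos hb m).ne'
    have h0 : Real.Gamma (b + 1) ≠ 0 := by simpa using h 0
    simpa [h, h0] using Real.hasSum_pow_div_factorial z
  | succ k ih =>
    intro b hb z
    have h : ∀ m : ℕ, Real.Gamma (m + b + 1) ≠ 0 := fun m =>
      (Gamma_natCast_add_add_one_pos hb m).ne'
    have h1 := (ih (b := b + 1) (by linarith) z).mul_left z
    have h2 := (ih hb z).mul_left (b + k + 1)
    have h3 : HasSum (fun m : ℕ => m * (z ^ m / m.factorial * (Real.Gamma (m + k + b + 1) /
        Real.Gamma (m + b + 1)))) (z * (Real.exp z * ∑ i ∈ Finset.range (k + 1),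
        k.choose i * z ^ i * (Real.Gamma (k + (b + 1) + 1) / Real.Gamma (i + (b + 1) + 1)))) := by
      rw [← hasSum_nat_add_iff' 1]
      simp only [Finset.range_one, Finset.sum_singleton, Nat.cast_zero, zero_mul, sub_zero]
      refine h1.congr_fun ?_
      intro m
      rw [Nat.factorial_succ]
      push_cast
      have e1 : (m : ℝ) + 1 + k + b + 1 = m + k + (b + 1) + 1 := by ring
      have e2 : (m : ℝ) + 1 + b + 1 = m + (b + 1) + 1 := by ring
      rw [e1, e2]
      field_simp
      ring
    have h4 := h3.add h2
    convert h4 using 1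
    · funext m
      have e : ((m : ℝ) + (k + 1 : ℕ) + b + 1) = (m + k + b + 1) + 1 := by push_cast; ring
      rw [e, Real.Gamma_add_one (by positivity)]
      ring
    · have e : (((k + 1 : ℕ) : ℝ) + b + 1) = (k + b + 1) + 1 := by push_cast; ring
      have e' : ((k : ℝ) + (b + 1) + 1) = (k + b + 1) + 1 := by ring
      have hG : Real.Gamma ((k + b + 1) + 1) = (k + b + 1) * Real.Gamma (k + b + 1) :=
        Real.Gamma_add_one (by positivity)
      rw [e, e', Finset.sum_range_succ' _ (k + 1)]
      have hs : ∑ i ∈ Finset.range (k + 1), ((k + 1).choose (i + 1) : ℝ) * z ^ (i + 1) *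
            (Real.Gamma ((k + b + 1) + 1) / Real.Gamma ((i + 1 : ℕ) + b + 1)) =
          z * ∑ i ∈ Finset.range (k + 1), (k.choose i : ℝ) * z ^ i *
            (Real.Gamma ((k + b + 1) + 1) / Real.Gamma (i + (b + 1) + 1)) +
          (b + k + 1) * ∑ i ∈ Finset.range k, (k.choose (i + 1) : ℝ) * z ^ (i + 1) *
            (Real.Gamma (k + b + 1) / Real.Gamma ((i + 1 : ℕ) + b + 1)) := by
        have hlast : ∑ i ∈ Finset.range k, (k.choose (i + 1) : ℝ) * z ^ (i + 1) *
            (Real.Gamma (k + b + 1) / Real.Gamma ((i + 1 : ℕ) + b + 1)) =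
            ∑ i ∈ Finset.range (k + 1), (k.choose (i + 1) : ℝ) * z ^ (i + 1) *
            (Real.Gamma (k + b + 1) / Real.Gamma ((i + 1 : ℕ) + b + 1)) := by
          rw [Finset.sum_range_succ]; simp
        rw [hlast, Finset.mul_sum, Finset.mul_sum, ← Finset.sum_add_distrib]
        refine Finset.sum_congr rfl fun i _ => ?_
        have e2 : ((i + 1 : ℕ) : ℝ) + b + 1 = i + (b + 1) + 1 := by push_cast; ring
        rw [Nat.choose_succ_succ, e2, hG]
        push_cast
        ring
      have hr := Finset.sum_range_succ' (fun i => (k.choose i : ℝ) * z ^ i *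
        (Real.Gamma (k + b + 1) / Real.Gamma (i + b + 1))) k
      rw [hs, hr, hG]
      simp only [Nat.choose_zero_right, Nat.cast_one, pow_zero, Nat.cast_zero]
      ring

/-- Terms with k < i vanish; for the others C(n,k) C(k,i) = C(n,i) C(n-i,k-i), and the binomial
theorem applies. With v = 1 - r this produces the eigenvalue power of r. -/
theorem sum_choose_mul_choose_mul_neg_one_pow {n i : ℕ} (hi : i ≤ n) (v : ℝ) :
    ∑ k ∈ Finset.range (n + 1), (n.choose k : ℝ) * k.choose i * (-1) ^ k * v ^ (k - i) =
      n.choose i * (-1) ^ i * (1 - v) ^ (n - i) := by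
  obtain ⟨p, rfl⟩ := Nat.exists_eq_add_of_le hi
  rw [add_assoc, Finset.sum_range_add, Finset.sum_eq_zero, zero_add, Nat.add_sub_cancel_left,
    sub_eq_add_neg, add_comm (1 : ℝ), add_pow, Finset.mul_sum]
  · refine Finset.sum_congr rfl fun k hk => ?_
    have hk' : k ≤ p := Nat.lt_succ_iff.1 (Finset.mem_range.1 hk)
    have := Nat.choose_mul (n := i + p) (k := i + k) (s := i) (by omega)
    rw [Nat.add_sub_cancel_left, Nat.add_sub_cancel_left] at this
    rw [Nat.add_sub_cancel_left, pow_add, one_pow, neg_pow v k]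
    have h' : ((i + p).choose (i + k) : ℝ) * ((i + k).choose i) =
        (i + p).choose i * p.choose k := by
      exact_mod_cast this
    rw [h']
    ring
  · intro k hk
    rw [Nat.choose_eq_zero_of_lt (Finset.mem_range.1 hk)]
    simp

theorem Gamma_add_natCast_eq_ascPochhammer (j : ℕ) {c : ℝ} (hc : 0 < c) :
    Real.Gamma (c + j) = (ascPochhammer ℝ j).eval c * Real.Gamma c := by
  induction j with
  | zero => simp
  | succ j ih =>
    rw [ascPochhammer_succ_eval]
    push_cast
    rw [← add_assoc, Real.Gamma_add_one (by positivity), ih]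
    ring

/-- Finite differences of the ratio of Gamma functions. -/
theorem sum_choose_mul_Gamma_ratio {b : ℝ} (hb : 0 ≤ b) {n j : ℕ} (hj : j ≤ n) :
    ∑ k ∈ Finset.range (n + 1), (-1) ^ k * (n.choose k : ℝ) *
        (Real.Gamma (k + j + b + 1) / Real.Gamma (k + b + 1)) =
      if j = n then (-1) ^ n * (n.factorial : ℝ) else 0 := by
  -- The Gamma ratio, as a function of k, is a monic polynomial of degree j. The alternating sum is
  -- its n-th difference up to sign: n! if j = n, zero if j < n.
  set P : Polynomial ℝ := (ascPochhammer ℝ j).comp (Polynomial.X + Polynomial.C (b + 1)) with hP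
  have hmon : P.Monic := (monic_ascPochhammer ℝ j).comp (Polynomial.monic_X_add_C _)
    (by rw [Polynomial.natDegree_X_add_C]; exact one_ne_zero)
  have hdeg : P.natDegree = j := by
    rw [hP, Polynomial.natDegree_comp, ascPochhammer_natDegree, Polynomial.natDegree_X_add_C,
      mul_one]
  have hs : ∑ k ∈ Finset.range (n + 1), (-1) ^ k * (n.choose k : ℝ) *
      (Real.Gamma (k + j + b + 1) / Real.Gamma (k + b + 1)) =
      (-1) ^ n * (fwdDiff 1)^[n] (fun x => Polynomial.eval x P) 0 := by
    rw [fwdDiff_iter_eq_sum_shift, Finset.mul_sum]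
    refine Finset.sum_congr rfl fun k hk => ?_
    have hk' : k ≤ n := Nat.lt_succ_iff.1 (Finset.mem_range.1 hk)
    have hG := Gamma_natCast_add_add_one_pos hb k
    have e : (k : ℝ) + j + b + 1 = (k + b + 1) + j := by ring
    rw [e, Gamma_add_natCast_eq_ascPochhammer j (by positivity), mul_div_assoc, div_self hG.ne',
      mul_one]
    have e2 : (-1 : ℝ) ^ n * (-1) ^ (n - k) = (-1) ^ k := by
      obtain ⟨p, rfl⟩ := Nat.exists_eq_add_of_le hk'
      rw [Nat.add_sub_cancel_left, pow_add, mul_assoc, ← mul_pow]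
      simp
    have e3 : Polynomial.eval (0 + k • (1 : ℝ)) P = (ascPochhammer ℝ j).eval (k + b + 1) := by
      simp [hP, add_assoc]
    rw [e3, zsmul_eq_mul]
    push_cast
    rw [← e2]
    ring
  rw [hs]
  split_ifs with h
  · subst h
    have := Polynomial.fwdDiff_iter_degree_eq_factorial P
    rw [hdeg] at this
    rw [this, hmon.leadingCoeff]
    simp
  · have := Polynomial.fwdDiff_iter_eq_zero_of_degree_lt (P := P) (n := n) (by omega)
    rw [this]
    simp

/-- Powers times exponentials are bounded on the half line. -/
theorem exists_rpow_mul_exp_neg_le {s δ : ℝ} (hs : 0 ≤ s) (hδ : 0 < δ) :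
    ∃ C, 0 < C ∧ ∀ x, 0 < x → x ^ s * Real.exp (-(δ * x)) ≤ C := by
  set n := ⌈s⌉₊
  refine ⟨1 + n.factorial / δ ^ n, by positivity, fun x hx => ?_⟩
  have h1 : x ^ s ≤ 1 + x ^ n := by
    rcases le_total x 1 with h | h
    · have := Real.rpow_le_one hx.le h hs
      have : 0 ≤ x ^ n := by positivity
      linarith
    · have := Real.rpow_le_rpow_of_exponent_le h (Nat.le_ceil s)
      rw [Real.rpow_natCast] at this
      linarith
  have h2 := Real.pow_div_factorial_le_exp (δ * x) (by positivity) n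
  have h3 : x ^ n ≤ n.factorial / δ ^ n * Real.exp (δ * x) := by
    rw [mul_pow, div_le_iff₀ (by positivity)] at h2
    rw [div_mul_eq_mul_div, le_div_iff₀ (by positivity)]
    linarith
  have h4 : 1 ≤ Real.exp (δ * x) := Real.one_le_exp (by positivity)
  rw [Real.exp_neg, ← div_eq_mul_inv, div_le_iff₀ (Real.exp_pos _)]
  nlinarith

/-! ### One-dimensional Laguerre functions -/

/-- The monomial of degree `k` times the square root of the Laguerre weight of order `b`. -/
noncomputable def laguerreMonomial (b : ℝ) (k : ℕ) (x : ℝ) : ℝ :=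
  x ^ k * (x ^ (b / 2) * Real.exp (-x / 2))

/-- The coefficients of the Laguerre functions in the basis of weighted monomials. -/
noncomputable def laguerreCoeff (b : ℝ) (n k : ℕ) : ℝ :=
  Real.sqrt (Real.Gamma (n + 1) / Real.Gamma (n + b + 1)) *
    (Real.Gamma (n + b + 1) / Real.Gamma (k + b + 1) *
      ((-1) ^ k / ((k.factorial : ℝ) * ((n - k).factorial : ℝ))))

theorem laguerreFun_eq_sum (b : ℝ) (n : ℕ) (x : ℝ) :
    laguerreFun b n x =
      ∑ k ∈ Finset.range (n + 1), laguerreCoeff b n k * laguerreMonomial b k x := by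
  simp only [laguerreFun, laguerrePoly, Finset.mul_sum, Finset.sum_mul, laguerreCoeff,
    laguerreMonomial]
  refine Finset.sum_congr rfl fun k _ => ?_
  rw [neg_pow]
  ring

theorem laguerreCoeff_self_ne_zero {b : ℝ} (hb : 0 ≤ b) (n : ℕ) : laguerreCoeff b n n ≠ 0 := by
  have h := Gamma_natCast_add_add_one_pos hb n
  have h' : 0 < Real.Gamma (n + 1) := Real.Gamma_pos_of_pos (by positivity)
  have h2 : 0 < √(Real.Gamma (n + 1) / Real.Gamma (n + b + 1)) := Real.sqrt_pos.2 (by positivity)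
  have h3 : ((-1 : ℝ) ^ n) ≠ 0 := by simp
  rw [laguerreCoeff]
  refine mul_ne_zero h2.ne' (mul_ne_zero (by positivity) (div_ne_zero h3 (by positivity)))

theorem laguerreMonomial_eq_rpow {b : ℝ} (k : ℕ) {x : ℝ} (hx : 0 < x) :
    laguerreMonomial b k x = x ^ (k + b / 2) * Real.exp (-(1 / 2 * x)) := by
  rw [laguerreMonomial, Real.rpow_add hx, Real.rpow_natCast]
  ring_nf

theorem measurable_laguerreMonomial (b : ℝ) (k : ℕ) : Measurable (laguerreMonomial b k) := by
  unfold laguerreMonomial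
  fun_prop

theorem measurable_laguerreFun (b : ℝ) (n : ℕ) : Measurable (laguerreFun b n) := by
  have : laguerreFun b n = fun x =>
      ∑ k ∈ Finset.range (n + 1), laguerreCoeff b n k * laguerreMonomial b k x :=
    funext (laguerreFun_eq_sum b n)
  rw [this]
  exact Finset.measurable_sum _ fun k _ => (measurable_laguerreMonomial b k).const_mul _

theorem integrable_laguerreMonomial {b : ℝ} (hb : 0 ≤ b) (k : ℕ) :
    Integrable (laguerreMonomial b k) (volume.restrict (Set.Ioi 0)) := by
  have := integrableOn_rpow_mul_exp_neg_mul (c := k + b / 2) (p := 1 / 2)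
    (by have : (0 : ℝ) ≤ k + b / 2 := by positivity
        linarith) (by norm_num)
  exact this.congr_fun (fun x hx => (laguerreMonomial_eq_rpow k hx).symm) measurableSet_Ioi

theorem laguerreMonomial_mul (b : ℝ) (j k : ℕ) {x : ℝ} (hx : 0 < x) :
    laguerreMonomial b j x * laguerreMonomial b k x = x ^ (k + j + b) * Real.exp (-(1 * x)) := by
  rw [laguerreMonomial_eq_rpow j hx, laguerreMonomial_eq_rpow k hx, mul_mul_mul_comm,
    ← Real.rpow_add hx, ← Real.exp_add]
  ring_nf

theorem integrable_laguerreMonomial_mul {b : ℝ} (hb : 0 ≤ b) (j k : ℕ) :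
    Integrable (fun x => laguerreMonomial b j x * laguerreMonomial b k x)
      (volume.restrict (Set.Ioi 0)) := by
  have := integrableOn_rpow_mul_exp_neg_mul (c := k + j + b) (p := 1)
    (by have : (0 : ℝ) ≤ k + j + b := by positivity
        linarith) one_pos
  exact this.congr_fun (fun x hx => (laguerreMonomial_mul b j k hx).symm) measurableSet_Ioi

theorem integral_laguerreMonomial_mul {b : ℝ} (hb : 0 ≤ b) (j k : ℕ) :
    ∫ x in Set.Ioi 0, laguerreMonomial b j x * laguerreMonomial b k x =
      Real.Gamma (k + j + b + 1) := by
  have := Real.integral_rpow_mul_exp_neg_mul_Ioi (a := k + j + b + 1) (r := 1)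
    (by positivity) one_pos
  rw [add_sub_cancel_right, div_one, Real.one_rpow, one_mul] at this
  rw [← this]
  exact setIntegral_congr_fun measurableSet_Ioi fun x hx => laguerreMonomial_mul b j k hx

theorem integrable_laguerreMonomial_mul_laguerreFun {b : ℝ} (hb : 0 ≤ b) (j n : ℕ) :
    Integrable (fun x => laguerreMonomial b j x * laguerreFun b n x)
      (volume.restrict (Set.Ioi 0)) := by
  simp only [laguerreFun_eq_sum, Finset.mul_sum, mul_left_comm _ (laguerreCoeff _ _ _)]
  exact integrable_finsetSum _ fun k _ => (integrable_laguerreMonomial_mul hb j k).const_mul _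

/-- Integrating monomial by monomial leaves the n-th finite difference of a polynomial of degree j.
This is the orthogonality of the Laguerre function to all lower degrees, with the constant for equal
degree. -/
theorem integral_laguerreMonomial_mul_laguerreFun {b : ℝ} (hb : 0 ≤ b) {j n : ℕ} (hj : j ≤ n) :
    ∫ x in Set.Ioi 0, laguerreMonomial b j x * laguerreFun b n x =
      if j = n then Real.sqrt (Real.Gamma (n + 1) / Real.Gamma (n + b + 1)) *
        ((-1) ^ n * Real.Gamma (n + b + 1)) else 0 := by
  simp only [laguerreFun_eq_sum, Finset.mul_sum, mul_left_comm _ (laguerreCoeff _ _ _)]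
  rw [integral_finsetSum _ fun k _ => (integrable_laguerreMonomial_mul hb j k).const_mul _]
  simp only [integral_const_mul, integral_laguerreMonomial_mul hb]
  have hs : ∀ k ∈ Finset.range (n + 1), laguerreCoeff b n k * Real.Gamma (k + j + b + 1) =
      Real.sqrt (Real.Gamma (n + 1) / Real.Gamma (n + b + 1)) * Real.Gamma (n + b + 1) /
        n.factorial * ((-1) ^ k * (n.choose k : ℝ) *
        (Real.Gamma (k + j + b + 1) / Real.Gamma (k + b + 1))) := by
    intro k hk
    have hk' : k ≤ n := Nat.lt_succ_iff.1 (Finset.mem_range.1 hk)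
    rw [Nat.cast_choose ℝ hk', laguerreCoeff]
    have := Gamma_natCast_add_add_one_pos hb k
    field_simp
  rw [Finset.sum_congr rfl hs, ← Finset.mul_sum, sum_choose_mul_Gamma_ratio hb hj]
  split_ifs
  · field_simp
  · simp

theorem integrable_laguerreFun_mul {b : ℝ} (hb : 0 ≤ b) (m n : ℕ) :
    Integrable (fun x => laguerreFun b m x * laguerreFun b n x)
      (volume.restrict (Set.Ioi 0)) := by
  have : (fun x => laguerreFun b m x * laguerreFun b n x) = fun x =>
      ∑ k ∈ Finset.range (m + 1), laguerreCoeff b m k *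
        (laguerreMonomial b k x * laguerreFun b n x) := by
    funext x
    rw [laguerreFun_eq_sum b m, Finset.sum_mul]
    simp only [mul_assoc]
  rw [this]
  exact integrable_finsetSum _ fun k _ =>
    (integrable_laguerreMonomial_mul_laguerreFun hb k n).const_mul _

theorem integral_laguerreFun_mul_of_le {b : ℝ} (hb : 0 ≤ b) {m n : ℕ} (hmn : m ≤ n) :
    ∫ x in Set.Ioi 0, laguerreFun b m x * laguerreFun b n x = if m = n then 1 else 0 := by
  have : (fun x => laguerreFun b m x * laguerreFun b n x) = fun x =>
      ∑ k ∈ Finset.range (m + 1), laguerreCoeff b m k *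
        (laguerreMonomial b k x * laguerreFun b n x) := by
    funext x
    rw [laguerreFun_eq_sum b m, Finset.sum_mul]
    simp only [mul_assoc]
  rw [this, integral_finsetSum _ fun k _ =>
    (integrable_laguerreMonomial_mul_laguerreFun hb k n).const_mul _]
  simp only [integral_const_mul]
  -- The monomials of degree below m ≤ n are orthogonal to the n-th function, so only the leading
  -- coefficient of the m-th one matters.
  rw [Finset.sum_range_succ, Finset.sum_eq_zero, zero_add,
    integral_laguerreMonomial_mul_laguerreFun hb hmn]
  · split_ifs with h
    · subst h
      have hG := Gamma_natCast_add_add_one_pos hb m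
      have hG' : 0 < Real.Gamma (m + 1) := Real.Gamma_pos_of_pos (by positivity)
      rw [laguerreCoeff]
      have e : ((-1 : ℝ) ^ m) * (-1) ^ m = 1 := by rw [← mul_pow]; simp
      have e2 := Real.mul_self_sqrt (x := Real.Gamma (m + 1) / Real.Gamma (m + b + 1))
        (by positivity)
      set s := √(Real.Gamma (m + 1) / Real.Gamma (m + b + 1))
      rw [div_self hG.ne', Nat.sub_self, Nat.factorial_zero, Nat.cast_one, mul_one, one_mul]
      calc s * ((-1) ^ m / m.factorial) * (s * ((-1) ^ m * Real.Gamma (m + b + 1)))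
          = (s * s) * ((-1) ^ m * (-1) ^ m) * (Real.Gamma (m + b + 1) / m.factorial) := by ring
        _ = 1 := by
          rw [e, e2, ← Real.Gamma_nat_eq_factorial]
          field_simp
    · simp
  · intro k hk
    have hk' : k < m := Finset.mem_range.1 hk
    rw [integral_laguerreMonomial_mul_laguerreFun hb (by omega), if_neg (by omega), mul_zero]

theorem integral_laguerreFun_mul {b : ℝ} (hb : 0 ≤ b) (m n : ℕ) :
    ∫ x in Set.Ioi 0, laguerreFun b m x * laguerreFun b n x = if m = n then 1 else 0 := by
  rcases le_total m n with h | h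
  · exact integral_laguerreFun_mul_of_le hb h
  · simp only [mul_comm (laguerreFun b m _), integral_laguerreFun_mul_of_le hb h, eq_comm]

/-- The change of basis is triangular with nonzero diagonal, so it can be inverted degree by degree.
Orthogonality to Laguerre functions thereby becomes vanishing of moments. -/
theorem laguerreMonomial_mem_span {b : ℝ} (hb : 0 ≤ b) (n : ℕ) :
    laguerreMonomial b n ∈ Submodule.span ℝ (Set.range (laguerreFun b)) := by
  induction n using Nat.strong_induction_on with
  | _ n ih =>
    have h1 : laguerreFun b n = ∑ k ∈ Finset.range n, laguerreCoeff b n k • laguerreMonomial b k +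
        laguerreCoeff b n n • laguerreMonomial b n := by
      funext x
      rw [laguerreFun_eq_sum, Finset.sum_range_succ]
      simp
    have h2 : laguerreMonomial b n = (laguerreCoeff b n n)⁻¹ • (laguerreFun b n -
        ∑ k ∈ Finset.range n, laguerreCoeff b n k • laguerreMonomial b k) := by
      rw [h1, add_sub_cancel_left, inv_smul_smul₀ (laguerreCoeff_self_ne_zero hb n)]
    rw [h2]
    refine Submodule.smul_mem _ _ (Submodule.sub_mem _ (Submodule.subset_span ⟨n, rfl⟩)
      (Submodule.sum_mem _ fun k hk => Submodule.smul_mem _ _ (ih k (Finset.mem_range.1 hk))))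

/-! ### The one-dimensional heat kernel in closed form -/

/-- The Hille-Hardy closed form of the one-dimensional Laguerre heat kernel, `r = exp (-t)`. -/
noncomputable def hilleHardyKernel (b r x y : ℝ) : ℝ :=
  r ^ ((b + 1) / 2) * (1 - r) ^ (-(b + 1)) *
    (x ^ (b / 2) * Real.exp (-((1 + r) / (2 * (1 - r)) * x))) *
    (y ^ (b / 2) * Real.exp (-((1 + r) / (2 * (1 - r)) * y))) *
    besselSeries b (r / (1 - r) ^ 2 * x * y)

section HilleHardy

variable {b r : ℝ}

theorem hilleHardyKernel_comm (b r x y : ℝ) :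
    hilleHardyKernel b r x y = hilleHardyKernel b r y x := by
  rw [hilleHardyKernel, hilleHardyKernel, mul_right_comm _ x y]
  ring

theorem hilleHardyKernel_nonneg (hb : 0 ≤ b) (hr : 0 < r) (hr1 : r < 1) {x y : ℝ} (hx : 0 < x)
    (hy : 0 < y) : 0 ≤ hilleHardyKernel b r x y := by
  have h1 : 0 < 1 - r := by linarith
  have := besselSeries_nonneg (b := b) (z := r / (1 - r) ^ 2 * x * y) hb (by positivity)
  rw [hilleHardyKernel]
  positivity

theorem measurable_hilleHardyKernel (hb : 0 ≤ b) (r : ℝ) :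
    Measurable fun p : ℝ × ℝ => hilleHardyKernel b r p.1 p.2 := by
  unfold hilleHardyKernel
  refine Measurable.mul (by fun_prop) ((measurable_besselSeries hb).comp (by fun_prop))

/-- A product bound for the kernel. -/
theorem exists_hilleHardyKernel_le (hb : 0 ≤ b) (hr : 0 < r) (hr1 : r < 1) :
    ∃ C δ : ℝ, 0 < C ∧ 0 < δ ∧ ∀ x y, 0 < x → 0 < y → hilleHardyKernel b r x y ≤
      C * (x ^ (b / 2) * Real.exp (-(δ * x))) * (y ^ (b / 2) * Real.exp (-(δ * y))) := by
  have h1 : 0 < 1 - r := by linarith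
  have hG : 0 < Real.Gamma (b + 1) := Real.Gamma_pos_of_pos (by positivity)
  have hs : √r < 1 := by rw [Real.sqrt_lt' one_pos]; simpa using hr1
  have hs0 : 0 < √r := Real.sqrt_pos.2 hr
  have hss : √r * √r = r := Real.mul_self_sqrt hr.le
  set A := (1 + r) / (2 * (1 - r)) with hA
  -- Chosen so that the Bessel argument factors as (κx)(κy). The Bessel series then costs e^(κx)
  -- e^(κy), and a positive rate remains because A - κ = (1-√r)²/(2(1-r)).
  set κ := √r / (1 - r) with hκ
  refine ⟨r ^ ((b + 1) / 2) * (1 - r) ^ (-(b + 1)) / Real.Gamma (b + 1), A - κ, by positivity,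
    ?_, fun x y hx hy => ?_⟩
  · have : A - κ = (1 - √r) ^ 2 / (2 * (1 - r)) := by
      rw [hA, hκ]
      field_simp
      nlinarith
    rw [this]
    have : 0 < 1 - √r := by linarith
    positivity
  · have e : r / (1 - r) ^ 2 * x * y = (κ * x) * (κ * y) := by
      rw [hκ]
      field_simp
      rw [sq, hss]
    have hκ0 : 0 < κ := by positivity
    have hB := besselSeries_mul_le (b := b) (u := κ * x) (v := κ * y) hb (by positivity)
      (by positivity)
    rw [hilleHardyKernel, e]
    calc _ ≤ r ^ ((b + 1) / 2) * (1 - r) ^ (-(b + 1)) *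
          (x ^ (b / 2) * Real.exp (-(A * x))) * (y ^ (b / 2) * Real.exp (-(A * y))) *
          (Real.exp (κ * x) * Real.exp (κ * y) / Real.Gamma (b + 1)) := by gcongr
      _ = _ := by
        have e1 : ∀ u, Real.exp (-((A - κ) * u)) = Real.exp (-(A * u)) * Real.exp (κ * u) := by
          intro u
          rw [← Real.exp_add]
          ring_nf
        rw [e1, e1]
        ring

/-- Termwise integration gives ratios Γ(m+b/2+1)/(m! Γ(m+b+1)); log-convexity bounds them by
1/Γ(m+b/2+1), leaving a fractional exponential series at s = qx/A. All powers of x cancel, and the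
bound becomes 2√r/(1+r) times exp(s - Ax). -/
theorem integral_hilleHardyKernel_le (hb : 0 ≤ b) (hr : 0 < r) (hr1 : r < 1) {x : ℝ}
    (hx : 0 < x) :
    ∫ y in Set.Ioi 0, hilleHardyKernel b r x y ≤ 2 * √r / (1 + r) := by
  have h1 : 0 < 1 - r := by linarith
  set A := (1 + r) / (2 * (1 - r)) with hA
  have hA0 : 0 < A := by positivity
  set q := r / (1 - r) ^ 2 with hq
  have hq0 : 0 < q := by positivity
  -- Equivalent to 4r ≤ (1+r)². It makes the final exponent s - Ax nonpositive.
  have hqA : q ≤ A * A := by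
    rw [hq, hA, div_mul_div_comm, div_le_div_iff₀ (by positivity) (by positivity)]
    nlinarith [sq_nonneg (1 - r), mul_nonneg (sq_nonneg (1 - r)) (sq_nonneg (1 - r))]
  set w := q * x with hw
  have hw0 : 0 < w := by positivity
  set s := w / A with hs
  have hs0 : 0 < s := by positivity
  set F : ℕ → ℝ := fun m => w ^ m / (m.factorial * Real.Gamma (m + b + 1)) *
      ((1 / A) ^ (m + b / 2 + 1) * Real.Gamma (m + b / 2 + 1)) with hF
  have hF0 : ∀ m, 0 ≤ F m := fun m => by
    have := Gamma_natCast_add_add_one_pos hb m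
    have : 0 < Real.Gamma (m + b / 2 + 1) := Real.Gamma_pos_of_pos (by positivity)
    positivity
  have hFle : ∀ m, F m ≤ w ^ (-(b / 2)) / A * (s ^ (m + b / 2) / Real.Gamma (m + b / 2 + 1)) := by
    intro m
    have g1 := Gamma_natCast_add_add_one_pos hb m
    have g2 : 0 < Real.Gamma (m + b / 2 + 1) := Real.Gamma_pos_of_pos (by positivity)
    have g3 := Gamma_add_half_sq_le hb m
    have e1 : s ^ ((m : ℝ) + b / 2) = w ^ m * w ^ (b / 2) * (1 / A) ^ ((m : ℝ) + b / 2) := by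
      rw [hs, div_eq_mul_one_div, Real.mul_rpow hw0.le (by positivity), Real.rpow_add hw0,
        Real.rpow_natCast]
    have e2 : (1 / A) ^ ((m : ℝ) + b / 2 + 1) = (1 / A) ^ ((m : ℝ) + b / 2) * (1 / A) := by
      rw [Real.rpow_add (by positivity), Real.rpow_one]
    have e3 : w ^ (-(b / 2)) * w ^ (b / 2) = 1 := by
      rw [← Real.rpow_add hw0]; simp
    calc F m = w ^ m * (1 / A) ^ ((m : ℝ) + b / 2) / A *
          (Real.Gamma (m + b / 2 + 1) / (m.factorial * Real.Gamma (m + b + 1))) := by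
          simp only [hF]
          rw [e2]
          ring
      _ ≤ w ^ m * (1 / A) ^ ((m : ℝ) + b / 2) / A * (1 / Real.Gamma (m + b / 2 + 1)) := by
          gcongr ?_ * ?_
          rw [div_le_div_iff₀ (by positivity) g2, one_mul, ← sq]
          exact g3
      _ = (w ^ (-(b / 2)) * w ^ (b / 2)) * (w ^ m * (1 / A) ^ ((m : ℝ) + b / 2) / A *
          (1 / Real.Gamma (m + b / 2 + 1))) := by rw [e3, one_mul]
      _ = _ := by rw [e1]; ring
  have hpart : ∀ N, ∑ m ∈ Finset.range N, F m ≤ w ^ (-(b / 2)) / A * Real.exp s := by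
    intro N
    calc ∑ m ∈ Finset.range N, F m
        ≤ ∑ m ∈ Finset.range N,
          w ^ (-(b / 2)) / A * (s ^ (m + b / 2) / Real.Gamma (m + b / 2 + 1)) :=
          Finset.sum_le_sum fun m _ => hFle m
      _ = w ^ (-(b / 2)) / A *
          ∑ m ∈ Finset.range N, s ^ (m + b / 2) / Real.Gamma (m + b / 2 + 1) := by
          rw [Finset.mul_sum]
      _ ≤ _ := by
          gcongr
          exact sum_rpow_div_Gamma_le_exp (by positivity) hs0.le N
  have hsum : Summable F := summable_of_sum_range_le hF0 hpart
  have hint := integral_rpow_mul_exp_mul_besselSeries (ρ := b / 2) hb (by linarith) hA0 hw0.le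
    hsum.hasSum
  have htsum : ∑' m, F m ≤ w ^ (-(b / 2)) / A * Real.exp s :=
    hsum.tsum_le_of_sum_range_le hpart
  have hval : ∫ y in Set.Ioi 0, hilleHardyKernel b r x y =
      r ^ ((b + 1) / 2) * (1 - r) ^ (-(b + 1)) * (x ^ (b / 2) * Real.exp (-(A * x))) *
        ∑' m, F m := by
    rw [← hint, ← integral_const_mul]
    congr 1
    funext y
    rw [hilleHardyKernel]
    ring
  rw [hval]
  calc _ ≤ r ^ ((b + 1) / 2) * (1 - r) ^ (-(b + 1)) * (x ^ (b / 2) * Real.exp (-(A * x))) *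
        (w ^ (-(b / 2)) / A * Real.exp s) := by gcongr
    _ = 2 * √r / (1 + r) * Real.exp (s - A * x) := by
      have e1 : w ^ (-(b / 2)) = r ^ (-(b / 2)) * (1 - r) ^ b * x ^ (-(b / 2)) := by
        rw [hw, hq, Real.mul_rpow hq0.le hx.le, Real.div_rpow hr.le (by positivity),
          ← Real.rpow_natCast (1 - r) 2, ← Real.rpow_mul h1.le]
        have : ((2 : ℕ) : ℝ) * -(b / 2) = -b := by push_cast; ring
        rw [this, Real.rpow_neg h1.le b, div_inv_eq_mul]
      have e2 : r ^ ((b + 1) / 2) * r ^ (-(b / 2)) = √r := by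
        rw [← Real.rpow_add hr, Real.sqrt_eq_rpow]
        ring_nf
      have e3 : (1 - r) ^ (-(b + 1)) * (1 - r) ^ b = (1 - r)⁻¹ := by
        rw [← Real.rpow_add h1, ← Real.rpow_neg_one]
        ring_nf
      have e4 : x ^ (b / 2) * x ^ (-(b / 2)) = 1 := by
        rw [← Real.rpow_add hx]; simp
      have e5 : Real.exp (s - A * x) = Real.exp (-(A * x)) * Real.exp s := by
        rw [← Real.exp_add]; ring_nf
      rw [e1, e5]
      calc _ = (r ^ ((b + 1) / 2) * r ^ (-(b / 2))) * ((1 - r) ^ (-(b + 1)) * (1 - r) ^ b) *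
            (x ^ (b / 2) * x ^ (-(b / 2))) / A * (Real.exp (-(A * x)) * Real.exp s) := by ring
        _ = _ := by
          rw [e2, e3, e4, hA]
          field_simp
    _ ≤ 2 * √r / (1 + r) * 1 := by
      gcongr
      rw [Real.exp_le_one_iff, hs, hw, sub_nonpos, div_le_iff₀ hA0]
      nlinarith
    _ = _ := mul_one _

/-- The exponential rate in y becomes A + 1/2 = 1/(1-r), so the termwise integrals form the
Gamma-ratio series at z = rx/(1-r). Its factor e^z combines with e^(-Ax) to e^(-x/2), which restores
the Laguerre weight. -/
theorem integral_hilleHardyKernel_mul_laguerreMonomial (hb : 0 ≤ b) (hr : 0 < r) (hr1 : r < 1)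
    {x : ℝ} (hx : 0 < x) (k : ℕ) :
    ∫ y in Set.Ioi 0, hilleHardyKernel b r x y * laguerreMonomial b k y =
      r ^ ((b + 1) / 2) * ∑ i ∈ Finset.range (k + 1), k.choose i * r ^ i * (1 - r) ^ (k - i) *
        (Real.Gamma (k + b + 1) / Real.Gamma (i + b + 1)) * laguerreMonomial b i x := by
  have h1 : 0 < 1 - r := by linarith
  set A := (1 + r) / (2 * (1 - r)) with hA
  have hp : A + 1 / 2 = 1 / (1 - r) := by
    rw [hA]; field_simp; ring
  set w := r / (1 - r) ^ 2 * x with hw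
  have hw0 : 0 < w := by positivity
  set z := w * (1 - r) with hz
  have hS := (hasSum_pow_div_factorial_mul_Gamma_ratio k hb z).mul_left ((1 - r) ^ (b + k + 1))
  have hint := integral_rpow_mul_exp_mul_besselSeries (ρ := b + k) (p := 1 / (1 - r)) hb
    (by have : (0 : ℝ) ≤ b + k := by positivity
        linarith) (by positivity) hw0.le (hS.congr_fun fun m => by
      rw [one_div_one_div, hz, mul_pow w (1 - r) m]
      have e : (1 - r) ^ ((m : ℝ) + (b + k) + 1) = (1 - r) ^ m * (1 - r) ^ (b + k + 1) := by
        rw [← Real.rpow_natCast (1 - r) m, ← Real.rpow_add h1]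
        ring_nf
      rw [e, show (m : ℝ) + (b + k) + 1 = m + k + b + 1 by ring]
      ring)
  have hval : ∫ y in Set.Ioi 0, hilleHardyKernel b r x y * laguerreMonomial b k y =
      r ^ ((b + 1) / 2) * (1 - r) ^ (-(b + 1)) * (x ^ (b / 2) * Real.exp (-(A * x))) *
      ∫ y in Set.Ioi 0, y ^ (b + k) * Real.exp (-(1 / (1 - r) * y)) * besselSeries b (w * y) := by
    rw [← integral_const_mul]
    refine setIntegral_congr_fun measurableSet_Ioi fun y hy => ?_
    have hy' : (0 : ℝ) < y := hy
    rw [hilleHardyKernel, laguerreMonomial_eq_rpow k hy', ← hp]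
    have e : y ^ (b + k) = y ^ (b / 2) * y ^ (k + b / 2) := by
      rw [← Real.rpow_add hy']; ring_nf
    have e' : Real.exp (-((A + 1 / 2) * y)) = Real.exp (-(A * y)) * Real.exp (-(1 / 2 * y)) := by
      rw [← Real.exp_add]; ring_nf
    rw [e, e']
    ring
  rw [hval, hint]
  have e1 : Real.exp (-(A * x)) * Real.exp z = Real.exp (-x / 2) := by
    rw [← Real.exp_add, hz, hw, hA]
    congr 1
    field_simp
    ring
  have e2 : (1 - r) ^ (-(b + 1)) * (1 - r) ^ (b + k + 1) = (1 - r) ^ k := by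
    rw [← Real.rpow_add h1, ← Real.rpow_natCast]
    ring_nf
  calc _ = r ^ ((b + 1) / 2) * ((1 - r) ^ (-(b + 1)) * (1 - r) ^ (b + k + 1)) *
        (x ^ (b / 2) * (Real.exp (-(A * x)) * Real.exp z)) *
        ∑ i ∈ Finset.range (k + 1), k.choose i * z ^ i *
        (Real.Gamma (k + b + 1) / Real.Gamma (i + b + 1)) := by ring
    _ = _ := by
      rw [e1, e2, mul_assoc, mul_assoc, Finset.mul_sum, Finset.mul_sum]
      congr 1
      refine Finset.sum_congr rfl fun i hi => ?_
      have hi' : i ≤ k := Nat.lt_succ_iff.1 (Finset.mem_range.1 hi)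
      have e3 : z = r * x / (1 - r) := by rw [hz, hw]; field_simp
      have e4 : (1 - r) ^ k = (1 - r) ^ (k - i) * (1 - r) ^ i := by
        rw [← pow_add, Nat.sub_add_cancel hi']
      rw [e3, e4, laguerreMonomial, div_pow, mul_pow]
      field_simp

theorem integrable_hilleHardyKernel_mul_laguerreMonomial (hb : 0 ≤ b) (hr : 0 < r) (hr1 : r < 1)
    {x : ℝ} (hx : 0 < x) (k : ℕ) :
    Integrable (fun y => hilleHardyKernel b r x y * laguerreMonomial b k y)
      (volume.restrict (Set.Ioi 0)) := by
  obtain ⟨C, δ, hC, hδ, hle⟩ := exists_hilleHardyKernel_le hb hr hr1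
  obtain ⟨D, hD, hDle⟩ := exists_rpow_mul_exp_neg_le (s := b / 2) (by positivity) hδ
  refine (integrable_laguerreMonomial hb k).bdd_mul
    (c := C * (x ^ (b / 2) * Real.exp (-(δ * x))) * D)
    ((measurable_hilleHardyKernel hb r).comp
      (measurable_const.prodMk measurable_id)).aestronglyMeasurable ?_
  filter_upwards [ae_restrict_mem measurableSet_Ioi] with y hy
  rw [Real.norm_of_nonneg (hilleHardyKernel_nonneg hb hr hr1 hx hy)]
  refine (hle x y hx hy).trans ?_
  gcongr
  exact hDle y hy

/-- The Laguerre functions are eigenfunctions of the integral operator. -/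
theorem integral_hilleHardyKernel_mul_laguerreFun (hb : 0 ≤ b) (hr : 0 < r) (hr1 : r < 1)
    {x : ℝ} (hx : 0 < x) (n : ℕ) :
    ∫ y in Set.Ioi 0, hilleHardyKernel b r x y * laguerreFun b n y =
      r ^ ((b + 1) / 2) * r ^ n * laguerreFun b n x := by
  simp only [laguerreFun_eq_sum, Finset.mul_sum, mul_left_comm _ (laguerreCoeff _ _ _)]
  rw [integral_finsetSum _ fun k _ =>
    (integrable_hilleHardyKernel_mul_laguerreMonomial hb hr hr1 hx k).const_mul _]
  simp only [integral_const_mul, integral_hilleHardyKernel_mul_laguerreMonomial hb hr hr1 hx]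
  -- Since C(k,i) = 0 for i > k, the inner sums may run over a range independent of k, and the two
  -- sums can be exchanged.
  have ext : ∀ k ∈ Finset.range (n + 1), ∑ i ∈ Finset.range (k + 1),
      (k.choose i : ℝ) * r ^ i * (1 - r) ^ (k - i) *
        (Real.Gamma (k + b + 1) / Real.Gamma (i + b + 1)) * laguerreMonomial b i x =
      ∑ i ∈ Finset.range (n + 1),
      (k.choose i : ℝ) * r ^ i * (1 - r) ^ (k - i) *
        (Real.Gamma (k + b + 1) / Real.Gamma (i + b + 1)) * laguerreMonomial b i x := by
    intro k hk
    refine Finset.sum_subset (Finset.range_subset_range.2 (Finset.mem_range.1 hk)) fun i _ hi => ?_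
    rw [Nat.choose_eq_zero_of_lt (by rw [Finset.mem_range] at hi; omega)]
    simp
  rw [Finset.sum_congr rfl fun k hk => by rw [ext k hk]]
  simp only [Finset.mul_sum]
  rw [Finset.sum_comm]
  refine Finset.sum_congr rfl fun i hi => ?_
  have hi' : i ≤ n := Nat.lt_succ_iff.1 (Finset.mem_range.1 hi)
  -- The sum over k yields r^(n-i); with the r^i already present this is r^n for every i.
  have key := sum_choose_mul_choose_mul_neg_one_pow hi' (1 - r)
  rw [sub_sub_cancel] at key
  have hGi := Gamma_natCast_add_add_one_pos hb i
  have e : ∀ k ∈ Finset.range (n + 1), laguerreCoeff b n k * (r ^ ((b + 1) / 2) *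
      ((k.choose i : ℝ) * r ^ i * (1 - r) ^ (k - i) *
        (Real.Gamma (k + b + 1) / Real.Gamma (i + b + 1)) * laguerreMonomial b i x)) =
      (Real.sqrt (Real.Gamma (n + 1) / Real.Gamma (n + b + 1)) * Real.Gamma (n + b + 1) /
        n.factorial / Real.Gamma (i + b + 1) * r ^ ((b + 1) / 2) * r ^ i *
        laguerreMonomial b i x) *
      ((n.choose k : ℝ) * k.choose i * (-1) ^ k * (1 - r) ^ (k - i)) := by
    intro k hk
    have hk' : k ≤ n := Nat.lt_succ_iff.1 (Finset.mem_range.1 hk)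
    have := Gamma_natCast_add_add_one_pos hb k
    rw [Nat.cast_choose ℝ hk', laguerreCoeff]
    field_simp
  rw [Finset.sum_congr rfl e, ← Finset.mul_sum, key, Nat.cast_choose ℝ hi', laguerreCoeff]
  have e2 : r ^ n = r ^ i * r ^ (n - i) := by rw [← pow_add, Nat.add_sub_cancel' hi']
  rw [e2]
  field_simp

end HilleHardy

/-! ### Moment determinacy for exponentially integrable densities -/

section Moments

variable {d : ℕ} {μ : Measure (Fin d → ℝ)} {h : (Fin d → ℝ) → ℝ} {δ : ℝ}

theorem norm_le_sum_abs (x : Fin d → ℝ) : ‖x‖ ≤ ∑ i, |x i| := by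
  refine (pi_norm_le_iff_of_nonneg (by positivity)).2 fun i => ?_
  exact Finset.single_le_sum (f := fun i => |x i|) (fun i _ => abs_nonneg _) (Finset.mem_univ i)

theorem prod_abs_pow_le (hδ : 0 < δ) (n : Fin d → ℕ) (x : Fin d → ℝ) :
    |∏ i, x i ^ n i| ≤ (∏ i, (n i).factorial / δ ^ n i) * Real.exp (δ * ∑ i, |x i|) := by
  rw [Finset.abs_prod, Finset.mul_sum, Real.exp_sum, ← Finset.prod_mul_distrib]
  refine Finset.prod_le_prod (fun i _ => abs_nonneg _) fun i _ => ?_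
  have := Real.pow_div_factorial_le_exp (δ * |x i|) (by positivity) (n i)
  rw [mul_pow, div_le_iff₀ (by positivity)] at this
  rw [abs_pow, div_mul_eq_mul_div, le_div_iff₀ (by positivity)]
  linarith

theorem integrable_mul_of_le_exp (hint : Integrable (fun x => Real.exp (δ * ∑ i, |x i|) * h x) μ)
    (hh : AEStronglyMeasurable h μ) {F : (Fin d → ℝ) → ℝ} (hF : Measurable F) {C : ℝ}
    (hle : ∀ x, |F x| ≤ C * Real.exp (δ * ∑ i, |x i|)) :
    Integrable (fun x => F x * h x) μ := by
  refine (hint.norm.const_mul C).mono' (hF.aestronglyMeasurable.mul hh) (ae_of_all _ fun x => ?_)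
  rw [norm_mul, norm_mul, Real.norm_eq_abs, Real.norm_of_nonneg (Real.exp_pos _).le, ← mul_assoc]
  gcongr
  exact hle x

/-- The measure whose density is the positive part of `h`. -/
noncomputable def posPartMeasure (μ : Measure (Fin d → ℝ)) (h : (Fin d → ℝ) → ℝ) :
    Measure (Fin d → ℝ) :=
  μ.withDensity fun x => ENNReal.ofReal (h x)

theorem integral_posPartMeasure {E : Type*} [NormedAddCommGroup E] [NormedSpace ℝ E]
    (hh : AEStronglyMeasurable h μ) (F : (Fin d → ℝ) → E) :
    ∫ x, F x ∂(posPartMeasure μ h) = ∫ x, (max (h x) 0) • F x ∂μ := by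
  rw [posPartMeasure, integral_withDensity_eq_integral_toReal_smul₀ hh.aemeasurable.ennreal_ofReal
    (ae_of_all _ fun x => ENNReal.ofReal_lt_top)]
  simp only [ENNReal.toReal_ofReal']

theorem integrable_posPartMeasure (hh : AEStronglyMeasurable h μ) {F : (Fin d → ℝ) → ℝ}
    (hF : Measurable F) (hint : Integrable (fun x => F x * h x) μ) :
    Integrable F (posPartMeasure μ h) := by
  rw [posPartMeasure, integrable_withDensity_iff_integrable_smul₀' hh.aemeasurable.ennreal_ofReal
    (ae_of_all _ fun x => ENNReal.ofReal_lt_top)]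
  refine hint.mono ((hh.aemeasurable.ennreal_ofReal.ennreal_toReal.aestronglyMeasurable).smul
    hF.aestronglyMeasurable) (ae_of_all _ fun x => ?_)
  rw [ENNReal.toReal_ofReal', norm_smul, norm_mul, mul_comm]
  gcongr
  rw [Real.norm_of_nonneg (le_max_right _ _)]
  exact max_le (le_abs_self _) (abs_nonneg _)

/-- The two measures have densities h⁺ and h⁻, so a vanishing moment of h becomes an equality of
moments of positive measures. -/
theorem integral_posPartMeasure_sub (hh : AEStronglyMeasurable h μ) {F : (Fin d → ℝ) → ℝ}
    (hF : Measurable F) (hint : Integrable (fun x => F x * h x) μ) :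
    ∫ x, F x ∂(posPartMeasure μ h) - ∫ x, F x ∂(posPartMeasure μ (-h)) =
      ∫ x, F x * h x ∂μ := by
  have aux : ∀ g : (Fin d → ℝ) → ℝ, AEStronglyMeasurable g μ →
      Integrable (fun x => F x * g x) μ → Integrable (fun x => (max (g x) 0) • F x) μ := by
    intro g hg hi
    refine hi.mono ((hg.sup aestronglyMeasurable_const).smul hF.aestronglyMeasurable)
      (ae_of_all _ fun x => ?_)
    rw [norm_smul, norm_mul, mul_comm]
    gcongr
    rw [Real.norm_of_nonneg (le_max_right _ _)]
    exact max_le (le_abs_self _) (abs_nonneg _)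
  rw [integral_posPartMeasure hh, integral_posPartMeasure hh.neg,
    ← integral_sub (aux h hh hint) (aux _ hh.neg (by simpa using hint.neg))]
  congr 1
  funext x
  simp only [Pi.neg_apply, smul_eq_mul]
  rw [← sub_mul, mul_comm]
  congr 1
  rcases le_total 0 (h x) with h0 | h0
  · rw [max_eq_left h0, max_eq_right (by linarith)]; ring
  · rw [max_eq_right h0, max_eq_left (by linarith)]; ring

theorem continuousLinearMap_pow_eq_eval (L : StrongDual ℝ (Fin d → ℝ)) (n : ℕ) (x : Fin d → ℝ) :
    L x ^ n = MvPolynomial.eval x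
      ((∑ i, MvPolynomial.C (L (Pi.single i 1)) * MvPolynomial.X i) ^ n) := by
  rw [map_pow, map_sum]
  congr 1
  conv_lhs => rw [← Finset.univ_sum_single x, map_sum]
  refine Finset.sum_congr rfl fun i _ => ?_
  have : Pi.single i (x i) = x i • (Pi.single i (1 : ℝ) : Fin d → ℝ) := by
    rw [← Pi.single_smul]; simp
  rw [this, map_smul]
  simp [mul_comm]

/-- A power of a linear functional is a polynomial in the coordinates, hence a finite combination of
the monomials whose moments vanish. -/
theorem integral_linear_pow_mul_eq_zero (hδ : 0 < δ)
    (hint : Integrable (fun x => Real.exp (δ * ∑ i, |x i|) * h x) μ)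
    (hh : AEStronglyMeasurable h μ)
    (hmom : ∀ n : Fin d → ℕ, ∫ x, (∏ i, x i ^ n i) * h x ∂μ = 0)
    (L : StrongDual ℝ (Fin d → ℝ)) (n : ℕ) :
    Integrable (fun x => L x ^ n * h x) μ ∧ ∫ x, L x ^ n * h x ∂μ = 0 := by
  have hi : ∀ n : Fin d → ℕ, Integrable (fun x => (∏ i, x i ^ n i) * h x) μ := fun n =>
    integrable_mul_of_le_exp hint hh (by fun_prop) (prod_abs_pow_le hδ n)
  simp only [continuousLinearMap_pow_eq_eval, MvPolynomial.eval_eq', Finset.sum_mul, mul_assoc]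
  refine ⟨integrable_finsetSum _ fun k _ => (hi k).const_mul _, ?_⟩
  rw [integral_finsetSum _ fun (k : Fin d →₀ ℕ) _ => (hi k).const_mul _]
  refine Finset.sum_eq_zero fun k _ => ?_
  rw [integral_const_mul, hmom, mul_zero]

theorem HasFPowerSeriesAt.eventuallyEq_of_same {f g : ℂ → ℂ} {p : FormalMultilinearSeries ℂ ℂ ℂ}
    {z : ℂ} (hf : HasFPowerSeriesAt f p z) (hg : HasFPowerSeriesAt g p z) : f =ᶠ[𝓝 z] g := by
  filter_upwards [hf.eventually_hasSum_sub, hg.eventually_hasSum_sub] with w h1 h2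
  exact h1.unique h2

open ProbabilityTheory in
/-- Moments determine a density with exponential decay. -/
theorem ae_eq_zero_of_forall_moment_eq_zero (hδ : 0 < δ)
    (hint : Integrable (fun x => Real.exp (δ * ∑ i, |x i|) * h x) μ)
    (hh : AEStronglyMeasurable h μ)
    (hmom : ∀ n : Fin d → ℕ, ∫ x, (∏ i, x i ^ n i) * h x ∂μ = 0) : h =ᵐ[μ] 0 := by
  have hneg : Integrable (fun x => Real.exp (δ * ∑ i, |x i|) * (-h x)) μ := by
    simpa using hint.neg
  have hfin : ∀ g : (Fin d → ℝ) → ℝ, AEStronglyMeasurable g μ →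
      Integrable (fun x => Real.exp (δ * ∑ i, |x i|) * g x) μ →
      IsFiniteMeasure (posPartMeasure μ g) := by
    intro g hg hi
    have h1 : Integrable (fun _ => (1 : ℝ)) (posPartMeasure μ g) :=
      integrable_posPartMeasure hg measurable_const (integrable_mul_of_le_exp hi hg
        measurable_const (C := 1) fun x => by
          rw [abs_one, one_mul]
          exact Real.one_le_exp (by positivity))
    exact (integrable_const_iff_isFiniteMeasure one_ne_zero).1 h1
  have hf1 := hfin h hh hint
  have hf2 := hfin _ hh.neg hneg
  have heq : posPartMeasure μ h = posPartMeasure μ (-h) := by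
    refine Measure.ext_of_charFunDual (funext fun L => ?_)
    -- For |t| ≤ ε the exponent t L x is at most δ ∑ |x_i|, so the exponential moments exist; the +
    -- 1 covers L = 0.
    set ε := δ / (‖L‖ + 1) with hε
    have hε0 : 0 < ε := by positivity
    have hmem : ∀ g : (Fin d → ℝ) → ℝ, AEStronglyMeasurable g μ →
        Integrable (fun x => Real.exp (δ * ∑ i, |x i|) * g x) μ →
        Set.Ioo (-ε) ε ⊆ integrableExpSet L (posPartMeasure μ g) := by
      intro g hg hi t ht
      refine integrable_posPartMeasure hg (by fun_prop) (integrable_mul_of_le_exp hi hg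
        (by fun_prop) (C := 1) fun x => ?_)
      rw [Real.abs_exp, one_mul, Real.exp_le_exp]
      have ht' : |t| ≤ ε := (abs_lt.2 ht).le
      calc t * L x ≤ |t * L x| := le_abs_self _
        _ = |t| * ‖L x‖ := by rw [abs_mul, Real.norm_eq_abs]
        _ ≤ ε * (‖L‖ * ‖x‖) := by
          gcongr
          exact L.le_opNorm x
        _ ≤ ε * ((‖L‖ + 1) * ∑ i, |x i|) := by
          gcongr
          · linarith
          · exact norm_le_sum_abs x
        _ = δ * ∑ i, |x i| := by rw [hε]; field_simp
    have hint' : ∀ g : (Fin d → ℝ) → ℝ, AEStronglyMeasurable g μ →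
        Integrable (fun x => Real.exp (δ * ∑ i, |x i|) * g x) μ →
        {z : ℂ | z.re ∈ Set.Ioo (-ε) ε} ⊆
          {z : ℂ | z.re ∈ interior (integrableExpSet L (posPartMeasure μ g))} := by
      intro g hg hi z hz
      exact interior_maximal (hmem g hg hi) isOpen_Ioo hz
    have hpre : IsPreconnected {z : ℂ | z.re ∈ Set.Ioo (-ε) ε} :=
      ((convex_Ioo (-ε) ε).linear_preimage Complex.reLm).isPreconnected
    have h0 : (0 : ℂ) ∈ {z : ℂ | z.re ∈ Set.Ioo (-ε) ε} := by simp [hε0]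
    have han1 := (analyticOnNhd_complexMGF (X := L) (μ := posPartMeasure μ h)).mono
      (hint' h hh hint)
    have han2 := (analyticOnNhd_complexMGF (X := L) (μ := posPartMeasure μ (-h))).mono
      (hint' _ hh.neg hneg)
    -- Derivatives at 0 are the moments of L, on which the two measures agree. Both transforms
    -- therefore have the same power series at 0, and the identity theorem extends the equality to
    -- the strip |Re z| < ε.
    have hmoment : ∀ n : ℕ, iteratedDeriv n (complexMGF L (posPartMeasure μ h)) 0 =
        iteratedDeriv n (complexMGF L (posPartMeasure μ (-h))) 0 := by
      intro n
      rw [iteratedDeriv_complexMGF (hint' h hh hint h0),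
        iteratedDeriv_complexMGF (hint' _ hh.neg hneg h0)]
      simp only [zero_mul, Complex.exp_zero, mul_one, ← Complex.ofReal_pow]
      rw [integral_complex_ofReal, integral_complex_ofReal]
      congr 1
      obtain ⟨hLi, hL0⟩ := integral_linear_pow_mul_eq_zero hδ hint hh hmom L n
      have := integral_posPartMeasure_sub hh (F := fun x => L x ^ n) (by fun_prop) hLi
      rw [hL0] at this
      linarith
    have hev : complexMGF L (posPartMeasure μ h) =ᶠ[𝓝 0]
        complexMGF L (posPartMeasure μ (-h)) := by
      have p1 := (han1 0 h0).hasFPowerSeriesAt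
      have p2 := (han2 0 h0).hasFPowerSeriesAt
      simp only [hmoment] at p1
      exact p1.eventuallyEq_of_same p2
    have hall := han1.eqOn_of_preconnected_of_eventuallyEq han2 hpre h0 hev
    -- The strip contains the imaginary axis, and the value at I is the characteristic function at
    -- L.
    have hI : Complex.I ∈ {z : ℂ | z.re ∈ Set.Ioo (-ε) ε} := by simp [hε0]
    have := hall hI
    rw [charFunDual_apply, charFunDual_apply]
    simpa only [complexMGF, mul_comm Complex.I] using this
  have hlt : ∫⁻ x, ENNReal.ofReal (h x) ∂μ ≠ ∞ := by
    have := measure_ne_top (posPartMeasure μ h) Set.univ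
    rwa [posPartMeasure, withDensity_apply _ MeasurableSet.univ, Measure.restrict_univ] at this
  -- Now h⁺ = h⁻ almost everywhere; one of them is zero at each point, so both are.
  have hae := (withDensity_eq_iff hh.aemeasurable.ennreal_ofReal
    hh.neg.aemeasurable.ennreal_ofReal hlt).1 heq
  filter_upwards [hae] with x hx
  rcases le_total 0 (h x) with h0 | h0
  · have : ENNReal.ofReal (-h x) = 0 := ENNReal.ofReal_of_nonpos (by linarith)
    simp only [Pi.neg_apply] at hx
    rw [this, ENNReal.ofReal_eq_zero] at hx
    exact le_antisymm hx h0
  · have : ENNReal.ofReal (h x) = 0 := ENNReal.ofReal_of_nonpos h0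
    simp only [Pi.neg_apply] at hx
    rw [this, eq_comm, ENNReal.ofReal_eq_zero] at hx
    exact le_antisymm h0 (neg_nonpos.1 hx)

end Moments

/-! ### Integral operators with bounded symmetric kernels -/

section KernelOperator

variable {X 𝕜 : Type*} [MeasurableSpace X] [RCLike 𝕜] {μ : Measure X}

/-- A nonnegative symmetric kernel that is dominated by `Φ ⊗ Φ` with `Φ` bounded and
integrable. -/
structure IsDominatedKernel (μ : Measure X) (K : X → X → ℝ) (Φ : X → ℝ) : Prop where
  measurable : Measurable fun p : X × X => K p.1 p.2
  nonneg : ∀ x y, 0 ≤ K x y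
  comm : ∀ x y, K x y = K y x
  le : ∀ x y, K x y ≤ Φ x * Φ y
  measurable_bound : Measurable Φ
  bound_nonneg : ∀ x, 0 ≤ Φ x
  integrable_bound : Integrable Φ μ
  bounded : ∃ D, ∀ x, Φ x ≤ D

/-- Cut at height 1: where |f| > 1 one has |f| ≤ |f|^p, so that part is integrable, and the rest is
bounded. -/
theorem mem_LOneAddLInfty_of_memLp {p : ℝ≥0∞} (hp : 1 ≤ p) {f : X → 𝕜} (hf : MemLp f p μ) :
    f ∈ LOneAddLInfty 𝕜 μ := by
  rcases eq_or_ne p ∞ with rfl | hp'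
  · exact ⟨0, f, MemLp.zero, hf, by simp⟩
  have hm := hf.aestronglyMeasurable
  set S : Set X := {x | 1 < ‖f x‖} with hS
  have hSm : NullMeasurableSet S μ := nullMeasurableSet_lt aemeasurable_const hm.norm.aemeasurable
  refine ⟨S.indicator f, Sᶜ.indicator f, ?_, ?_, (Set.indicator_self_add_compl S f).symm⟩
  · rw [memLp_one_iff_integrable]
    have hint := hf.integrable_norm_rpow (by positivity) hp'
    refine hint.mono' (hm.indicator₀ hSm) (ae_of_all _ fun x => ?_)
    by_cases hx : x ∈ S
    · rw [Set.indicator_of_mem hx]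
      have h1 : 1 ≤ p.toReal := by
        rwa [← ENNReal.toReal_one, ENNReal.toReal_le_toReal ENNReal.one_ne_top hp']
      calc ‖f x‖ = ‖f x‖ ^ (1 : ℝ) := (Real.rpow_one _).symm
        _ ≤ ‖f x‖ ^ p.toReal := Real.rpow_le_rpow_of_exponent_le (le_of_lt hx) h1
    · rw [Set.indicator_of_notMem hx, norm_zero]
      positivity
  · refine memLp_top_of_bound (hm.indicator₀ hSm.compl) 1 (ae_of_all _ fun x => ?_)
    by_cases hx : x ∈ S
    · rw [Set.indicator_of_notMem (by simpa using hx)]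
      simp
    · rw [Set.indicator_of_mem (by simpa using hx)]
      exact not_lt.1 hx

theorem aestronglyMeasurable_of_mem_LOneAddLInfty {f : X → 𝕜} (hf : f ∈ LOneAddLInfty 𝕜 μ) :
    AEStronglyMeasurable f μ := by
  obtain ⟨g, h, hg, hh, rfl⟩ := hf
  exact hg.aestronglyMeasurable.add hh.aestronglyMeasurable

/-- The integral operator with kernel `K`. -/
noncomputable def kernelOp (μ : Measure X) (K : X → X → ℝ) (f : X → 𝕜) (x : X) : 𝕜 :=
  ∫ y, K x y • f y ∂μ

theorem kernelOp_congr (K : X → X → ℝ) {f g : X → 𝕜} (h : f =ᵐ[μ] g) :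
    kernelOp μ K f = kernelOp μ K g := by
  funext x
  refine integral_congr_ae ?_
  filter_upwards [h] with y hy
  simp only [hy]

namespace IsDominatedKernel

variable {K : X → X → ℝ} {Φ : X → ℝ} (hK : IsDominatedKernel μ K Φ)
include hK

theorem measurable_right (x : X) : Measurable (K x) :=
  hK.measurable.comp (measurable_const.prodMk measurable_id)

theorem memLp_bound (p : ℝ≥0∞) (hp : 1 ≤ p) : MemLp Φ p μ := by
  obtain ⟨D, hD⟩ := hK.bounded
  have h1 : MemLp Φ 1 μ := memLp_one_iff_integrable.2 hK.integrable_bound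
  have h2 : MemLp Φ ∞ μ := memLp_top_of_bound hK.measurable_bound.aestronglyMeasurable D
    (ae_of_all _ fun x => by rw [Real.norm_of_nonneg (hK.bound_nonneg x)]; exact hD x)
  rcases eq_or_ne p ∞ with rfl | hp'
  · exact h2
  refine ⟨h1.1, ?_⟩
  have h3 : 1 ≤ p.toReal := by
    rwa [← ENNReal.toReal_one, ENNReal.toReal_le_toReal ENNReal.one_ne_top hp']
  have hint : Integrable (fun x => ‖Φ x‖ ^ p.toReal) μ := by
    refine (hK.integrable_bound.const_mul (D ^ (p.toReal - 1))).mono'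
      (by have := hK.measurable_bound
          exact (by fun_prop : Measurable fun x => ‖Φ x‖ ^ p.toReal).aestronglyMeasurable)
      (ae_of_all _ fun x => ?_)
    have h0 := hK.bound_nonneg x
    rw [Real.norm_of_nonneg (by positivity), Real.norm_of_nonneg h0]
    calc Φ x ^ p.toReal = Φ x ^ (p.toReal - 1) * Φ x := by
          rcases h0.eq_or_lt with h | h
          · rw [← h, Real.zero_rpow (by linarith), mul_zero]
          · rw [← Real.rpow_add_one h.ne', sub_add_cancel]
      _ ≤ D ^ (p.toReal - 1) * Φ x := by
          gcongr
          exact hD x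
  exact ((integrable_norm_rpow_iff h1.1 (by positivity) hp').1 hint).2

theorem memLp_right (x : X) (p : ℝ≥0∞) (hp : 1 ≤ p) : MemLp (K x) p μ := by
  refine ((hK.memLp_bound p hp).const_mul (Φ x)).mono (hK.measurable_right x).aestronglyMeasurable
    (ae_of_all _ fun y => ?_)
  rw [Real.norm_of_nonneg (hK.nonneg x y)]
  exact (hK.le x y).trans (le_abs_self _)

/-- Boundedness of Φ handles the L¹ part of f, integrability of Φ the L^∞ part. This is the majorant
behind the Fubini arguments on L¹ + L^∞ below. -/
theorem integrable_bound_smul {f : X → 𝕜} (hf : f ∈ LOneAddLInfty 𝕜 μ) :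
    Integrable (fun y => Φ y • f y) μ := by
  obtain ⟨D, hD⟩ := hK.bounded
  obtain ⟨g, h, hg, hh, rfl⟩ := hf
  simp only [Pi.add_apply, smul_add]
  refine Integrable.add ?_ ?_
  · refine (memLp_one_iff_integrable.1 hg).bdd_smul D hK.measurable_bound.aestronglyMeasurable
      (ae_of_all _ fun x => ?_)
    rw [Real.norm_of_nonneg (hK.bound_nonneg x)]
    exact hD x
  · exact memLp_one_iff_integrable.1 (MemLp.smul (p := 1) (q := ∞) (r := 1) hh
      (memLp_one_iff_integrable.2 hK.integrable_bound))

theorem norm_smul_le (f : X → 𝕜) (x y : X) : ‖K x y • f y‖ ≤ Φ x * ‖Φ y • f y‖ := by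
  rw [norm_smul, norm_smul, Real.norm_of_nonneg (hK.nonneg x y),
    Real.norm_of_nonneg (hK.bound_nonneg y), ← mul_assoc]
  gcongr
  exact hK.le x y

theorem integrable_smul {f : X → 𝕜} (hf : f ∈ LOneAddLInfty 𝕜 μ) (x : X) :
    Integrable (fun y => K x y • f y) μ :=
  ((hK.integrable_bound_smul hf).norm.const_mul (Φ x)).mono'
    ((hK.measurable_right x).aestronglyMeasurable.smul
      (aestronglyMeasurable_of_mem_LOneAddLInfty hf))
    (ae_of_all _ fun y => hK.norm_smul_le f x y)

theorem enorm_kernelOp_le {f : X → 𝕜} (hf : AEStronglyMeasurable f μ) (x : X) :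
    ‖kernelOp μ K f x‖ₑ ≤ ∫⁻ y, ‖f y‖ₑ ∂(μ.withDensity fun y => ENNReal.ofReal (K x y)) := by
  rw [lintegral_withDensity_eq_lintegral_mul₀
    (hK.measurable_right x).ennreal_ofReal.aemeasurable hf.enorm]
  refine (enorm_integral_le_lintegral_enorm _).trans (le_of_eq (lintegral_congr fun y => ?_))
  rw [enorm_smul, Real.enorm_of_nonneg (hK.nonneg x y), Pi.mul_apply]

theorem withDensity_univ_le {M : ℝ} (hM : ∀ x, ∫ y, K x y ∂μ ≤ M) (x : X) :
    (μ.withDensity fun y => ENNReal.ofReal (K x y)) Set.univ ≤ ENNReal.ofReal M := by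
  rw [withDensity_apply _ MeasurableSet.univ, Measure.restrict_univ,
    ← ofReal_integral_eq_lintegral_ofReal (memLp_one_iff_integrable.1 (hK.memLp_right x 1 le_rfl))
      (ae_of_all _ (hK.nonneg x))]
  exact ENNReal.ofReal_le_ofReal (hM x)

/-- Hölder's inequality for the measure K(x, ·)μ, whose total mass is at most M. -/
theorem enorm_kernelOp_rpow_le {M : ℝ} (hM : ∀ x, ∫ y, K x y ∂μ ≤ M) {q : ℝ} (hq : 1 ≤ q)
    {f : X → 𝕜} (hf : AEStronglyMeasurable f μ) (x : X) :
    ‖kernelOp μ K f x‖ₑ ^ q ≤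
      ENNReal.ofReal M ^ (q - 1) * ∫⁻ y, ENNReal.ofReal (K x y) * ‖f y‖ₑ ^ q ∂μ := by
  set ρ := μ.withDensity fun y => ENNReal.ofReal (K x y) with hρ
  have hq0 : 0 < q := by linarith
  have hfρ : AEStronglyMeasurable f ρ := hf.mono_ac (withDensity_absolutelyContinuous _ _)
  have h1 := eLpNorm'_le_eLpNorm'_mul_rpow_measure_univ one_pos hq hfρ
  have h2 := hK.withDensity_univ_le hM x
  simp only [eLpNorm', ENNReal.rpow_one, div_one] at h1
  calc ‖kernelOp μ K f x‖ₑ ^ q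
      ≤ ((∫⁻ y, ‖f y‖ₑ ^ q ∂ρ) ^ (1 / q) * ρ Set.univ ^ (1 - 1 / q)) ^ q := by
        gcongr
        exact (hK.enorm_kernelOp_le hf x).trans h1
    _ = ρ Set.univ ^ (q - 1) * ∫⁻ y, ‖f y‖ₑ ^ q ∂ρ := by
        rw [ENNReal.mul_rpow_of_nonneg _ _ hq0.le, ← ENNReal.rpow_mul, ← ENNReal.rpow_mul,
          one_div_mul_cancel hq0.ne', ENNReal.rpow_one, sub_mul, one_div_mul_cancel hq0.ne',
          one_mul, mul_comm]
    _ ≤ ENNReal.ofReal M ^ (q - 1) * ∫⁻ y, ‖f y‖ₑ ^ q ∂ρ := by gcongr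
    _ = _ := by
        rw [hρ, lintegral_withDensity_eq_lintegral_mul₀
          (hK.measurable_right x).ennreal_ofReal.aemeasurable (hf.enorm.pow_const q)]
        rfl

theorem aestronglyMeasurable_kernelOp [SFinite μ] {f : X → 𝕜} (hf : AEStronglyMeasurable f μ) :
    AEStronglyMeasurable (kernelOp μ K f) μ :=
  AEStronglyMeasurable.integral_prod_right'
    (f := fun p : X × X => K p.1 p.2 • f p.2)
    (hK.measurable.aestronglyMeasurable.smul hf.comp_snd)

/-- The Schur test. -/
theorem eLpNorm_kernelOp_le [SFinite μ] {M : ℝ} (hM : ∀ x, ∫ y, K x y ∂μ ≤ M)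
    {p : ℝ≥0∞} (hp : 1 ≤ p) {f : X → 𝕜} (hf : AEStronglyMeasurable f μ) :
    eLpNorm (kernelOp μ K f) p μ ≤ ENNReal.ofReal M * eLpNorm f p μ := by
  rcases eq_or_ne p ∞ with rfl | hp'
  · rw [eLpNorm_exponent_top, eLpNorm_exponent_top]
    refine eLpNormEssSup_le_of_ae_enorm_bound (ae_of_all _ fun x => ?_)
    refine (hK.enorm_kernelOp_le hf x).trans ?_
    have hae : ∀ᵐ y ∂(μ.withDensity fun y => ENNReal.ofReal (K x y)),
        ‖f y‖ₑ ≤ eLpNormEssSup f μ :=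
      (withDensity_absolutelyContinuous _ _).ae_le (enorm_ae_le_eLpNormEssSup f μ)
    refine (lintegral_mono_ae hae).trans ?_
    rw [lintegral_const, mul_comm]
    gcongr
    exact hK.withDensity_univ_le hM x
  · have hp0 : p ≠ 0 := (one_pos.trans_le hp).ne'
    have hq : 1 ≤ p.toReal := by
      rwa [← ENNReal.toReal_one, ENNReal.toReal_le_toReal ENNReal.one_ne_top hp']
    set q := p.toReal
    have hq0 : 0 < q := by linarith
    rw [eLpNorm_eq_lintegral_rpow_enorm_toReal hp0 hp',
      eLpNorm_eq_lintegral_rpow_enorm_toReal hp0 hp']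
    have hmeas : AEMeasurable (fun z : X × X => ENNReal.ofReal (K z.1 z.2) * ‖f z.2‖ₑ ^ q)
        (μ.prod μ) :=
      hK.measurable.ennreal_ofReal.aemeasurable.mul (hf.comp_snd.enorm.pow_const q)
    have key : ∫⁻ x, ‖kernelOp μ K f x‖ₑ ^ q ∂μ ≤
        ENNReal.ofReal M ^ q * ∫⁻ y, ‖f y‖ₑ ^ q ∂μ := by
      calc ∫⁻ x, ‖kernelOp μ K f x‖ₑ ^ q ∂μ
          ≤ ∫⁻ x, ENNReal.ofReal M ^ (q - 1) *
              ∫⁻ y, ENNReal.ofReal (K x y) * ‖f y‖ₑ ^ q ∂μ ∂μ :=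
            lintegral_mono fun x => hK.enorm_kernelOp_rpow_le hM hq hf x
        _ = ENNReal.ofReal M ^ (q - 1) *
              ∫⁻ x, ∫⁻ y, ENNReal.ofReal (K x y) * ‖f y‖ₑ ^ q ∂μ ∂μ :=
            lintegral_const_mul'' _ hmeas.lintegral_prod_right'
        _ = ENNReal.ofReal M ^ (q - 1) *
              ∫⁻ y, ∫⁻ x, ENNReal.ofReal (K x y) * ‖f y‖ₑ ^ q ∂μ ∂μ := by
            rw [lintegral_lintegral_swap hmeas]
        _ ≤ ENNReal.ofReal M ^ (q - 1) * ∫⁻ y, ENNReal.ofReal M * ‖f y‖ₑ ^ q ∂μ := by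
            gcongr with y
            have := hK.withDensity_univ_le hM y
            rw [withDensity_apply _ MeasurableSet.univ, Measure.restrict_univ] at this
            -- By symmetry the column integrals are row integrals, so the same M bounds both and
            -- M^(q-1) · M gives the norm M for every exponent.
            simp only [fun x => hK.comm x y]
            rw [lintegral_mul_const _ (hK.measurable_right y).ennreal_ofReal]
            gcongr
        _ = _ := by
            rw [lintegral_const_mul' _ _ ENNReal.ofReal_ne_top, ← mul_assoc]
            congr 1
            nth_rw 2 [← ENNReal.rpow_one (ENNReal.ofReal M)]
            rw [← ENNReal.rpow_add_of_nonneg _ _ (by linarith) zero_le_one, sub_add_cancel]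
    calc (∫⁻ x, ‖kernelOp μ K f x‖ₑ ^ q ∂μ) ^ (1 / q)
        ≤ (ENNReal.ofReal M ^ q * ∫⁻ y, ‖f y‖ₑ ^ q ∂μ) ^ (1 / q) := by gcongr
      _ = _ := by
        rw [ENNReal.mul_rpow_of_nonneg _ _ (by positivity), ← ENNReal.rpow_mul,
          mul_one_div_cancel hq0.ne', ENNReal.rpow_one]

theorem memLp_kernelOp [SFinite μ] {M : ℝ} (hM : ∀ x, ∫ y, K x y ∂μ ≤ M)
    {p : ℝ≥0∞} (hp : 1 ≤ p) {f : X → 𝕜} (hf : MemLp f p μ) : MemLp (kernelOp μ K f) p μ :=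
  ⟨hK.aestronglyMeasurable_kernelOp hf.1,
    (hK.eLpNorm_kernelOp_le hM hp hf.1).trans_lt (ENNReal.mul_lt_top ENNReal.ofReal_lt_top hf.2)⟩

/-- The composition of two integral operators. -/
theorem kernelOp_kernelOp [SFinite μ] {K' : X → X → ℝ} {Φ' : X → ℝ}
    (hK' : IsDominatedKernel μ K' Φ') {f : X → 𝕜} (hf : f ∈ LOneAddLInfty 𝕜 μ) (x : X) :
    kernelOp μ K (kernelOp μ K' f) x =
      kernelOp μ (fun x y => ∫ z, K x z * K' z y ∂μ) f x := by
  have hfm := aestronglyMeasurable_of_mem_LOneAddLInfty hf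
  -- The majorant is a tensor product, Φ(x) Φ(z) Φ'(z) in z times Φ'(y) |f(y)| in y.
  have hint : Integrable (fun p : X × X => (K x p.1 * K' p.1 p.2) • f p.2) (μ.prod μ) := by
    have h1 : Integrable (fun z => Φ x * (Φ z * Φ' z)) μ := by
      obtain ⟨D, hD⟩ := hK.bounded
      refine (hK'.integrable_bound.bdd_mul (c := D) hK.measurable_bound.aestronglyMeasurable
        (ae_of_all _ fun z => ?_)).const_mul _
      rw [Real.norm_of_nonneg (hK.bound_nonneg z)]
      exact hD z
    refine (h1.mul_prod (hK'.integrable_bound_smul hf).norm).mono'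
      ((((hK.measurable_right x).comp measurable_fst).mul hK'.measurable).aestronglyMeasurable.smul
        hfm.comp_snd) (ae_of_all _ fun p => ?_)
    rw [mul_smul, norm_smul, Real.norm_of_nonneg (hK.nonneg _ _)]
    have e1 := hK.le x p.1
    have e2 := hK'.norm_smul_le f p.1 p.2
    have e3 := hK'.bound_nonneg p.1
    calc K x p.1 * ‖K' p.1 p.2 • f p.2‖ ≤ (Φ x * Φ p.1) * (Φ' p.1 * ‖Φ' p.2 • f p.2‖) := by
          gcongr
          exact mul_nonneg (hK.bound_nonneg _) (hK.bound_nonneg _)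
      _ = _ := by ring
  calc kernelOp μ K (kernelOp μ K' f) x
      = ∫ z, ∫ y, (K x z * K' z y) • f y ∂μ ∂μ := by
        simp only [kernelOp]
        congr 1
        funext z
        rw [← integral_smul]
        simp only [mul_smul]
    _ = ∫ y, ∫ z, (K x z * K' z y) • f y ∂μ ∂μ := integral_integral_swap hint
    _ = _ := by
        simp only [kernelOp]
        congr 1
        funext y
        rw [integral_smul_const]

theorem integral_kernelOp_mul [SFinite μ] {f g : X → 𝕜} (hf : f ∈ LOneAddLInfty 𝕜 μ)
    (hg : g ∈ LOneAddLInfty 𝕜 μ) :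
    ∫ x, kernelOp μ K f x * g x ∂μ = ∫ x, f x * kernelOp μ K g x ∂μ := by
  have hfm := aestronglyMeasurable_of_mem_LOneAddLInfty hf
  have hgm := aestronglyMeasurable_of_mem_LOneAddLInfty hg
  have hint : Integrable (fun p : X × X => K p.1 p.2 • (f p.2 * g p.1)) (μ.prod μ) := by
    refine ((hK.integrable_bound_smul hg).norm.mul_prod (hK.integrable_bound_smul hf).norm).mono'
      (hK.measurable.aestronglyMeasurable.smul (hfm.comp_snd.mul hgm.comp_fst))
      (ae_of_all _ fun p => ?_)
    rw [norm_smul, norm_smul, norm_smul, norm_mul, Real.norm_of_nonneg (hK.nonneg _ _),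
      Real.norm_of_nonneg (hK.bound_nonneg _), Real.norm_of_nonneg (hK.bound_nonneg _)]
    calc K p.1 p.2 * (‖f p.2‖ * ‖g p.1‖) ≤ (Φ p.1 * Φ p.2) * (‖f p.2‖ * ‖g p.1‖) := by
          gcongr
          exact hK.le _ _
      _ = _ := by ring
  calc ∫ x, kernelOp μ K f x * g x ∂μ
      = ∫ x, ∫ y, K x y • (f y * g x) ∂μ ∂μ := by
        congr 1
        funext x
        rw [kernelOp, ← integral_mul_const]
        simp only [smul_mul_assoc]
    _ = ∫ y, ∫ x, K x y • (f y * g x) ∂μ ∂μ := integral_integral_swap hint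
    _ = _ := by
        congr 1
        funext y
        rw [kernelOp, ← integral_const_mul]
        simp only [mul_smul_comm, fun x => hK.comm x y]

/-- The kernel is real, so the operator commutes with conjugation and the sesquilinear identity
follows from the bilinear one. -/
theorem integral_inner_kernelOp [SFinite μ] {f g : X → 𝕜} (hf : f ∈ LOneAddLInfty 𝕜 μ)
    (hg : g ∈ LOneAddLInfty 𝕜 μ) :
    ∫ x, inner 𝕜 (kernelOp μ K f x) (g x) ∂μ = ∫ x, inner 𝕜 (f x) (kernelOp μ K g x) ∂μ := by
  have hconj : (fun x => (starRingEnd 𝕜) (f x)) ∈ LOneAddLInfty 𝕜 μ := by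
    obtain ⟨u, v, hu, hv, rfl⟩ := hf
    exact ⟨_, _, hu.star, hv.star, by funext x; simp⟩
  have h := hK.integral_kernelOp_mul hg hconj
  have e : ∀ x, kernelOp μ K (fun x => (starRingEnd 𝕜) (f x)) x =
      (starRingEnd 𝕜) (kernelOp μ K f x) := by
    intro x
    rw [kernelOp, kernelOp, ← integral_conj]
    congr 1
    funext y
    rw [RCLike.real_smul_eq_coe_mul, RCLike.real_smul_eq_coe_mul, map_mul, RCLike.conj_ofReal]
  simp only [RCLike.inner_apply]
  simp only [e] at h
  exact h.symm

omit hK in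
theorem _root_.kernelOp_ofReal (K : X → X → ℝ) (f : X → ℝ) (x : X) :
    kernelOp μ K (fun y => (f y : 𝕜)) x = ((kernelOp μ K f x : ℝ) : 𝕜) := by
  rw [kernelOp, kernelOp, ← integral_ofReal]
  congr 1
  funext y
  rw [RCLike.real_smul_eq_coe_mul, smul_eq_mul, RCLike.ofReal_mul]

theorem kernelOp_nonneg {f : X → 𝕜} (hf : ∀ᵐ x ∂μ, 0 ≤ f x) (x : X) : 0 ≤ kernelOp μ K f x := by
  have h : f =ᵐ[μ] fun x => ((RCLike.re (f x) : ℝ) : 𝕜) := by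
    filter_upwards [hf] with x hx
    exact (RCLike.conj_eq_iff_re.1 (RCLike.conj_eq_iff_im.2 (RCLike.nonneg_iff.1 hx).2)).symm
  rw [kernelOp_congr K h, kernelOp_ofReal, RCLike.ofReal_nonneg]
  refine integral_nonneg_of_ae ?_
  filter_upwards [hf] with y hy
  exact mul_nonneg (hK.nonneg x y) (RCLike.nonneg_iff.1 hy).1

theorem kernelOp_add {f g : X → 𝕜} (hf : f ∈ LOneAddLInfty 𝕜 μ) (hg : g ∈ LOneAddLInfty 𝕜 μ) :
    kernelOp μ K (f + g) = kernelOp μ K f + kernelOp μ K g := by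
  funext x
  simp only [kernelOp, Pi.add_apply, smul_add]
  exact integral_add (hK.integrable_smul hf x) (hK.integrable_smul hg x)

omit hK in
theorem _root_.kernelOp_smul (K : X → X → ℝ) (c : 𝕜) (f : X → 𝕜) :
    kernelOp μ K (c • f) = c • kernelOp μ K f := by
  funext x
  simp only [kernelOp, Pi.smul_apply, smul_comm _ c]
  exact integral_smul c _

end IsDominatedKernel
end KernelOperator

/-! ### Multi-dimensional Laguerre functions -/

section LaguerreBasis

variable {d : ℕ} {β : Fin d → ℝ}

theorem posOrthant_eq_pi (d : ℕ) : posOrthant d = Set.univ.pi fun _ => Set.Ioi 0 := by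
  ext x
  simp [posOrthant]

theorem measurableSet_posOrthant (d : ℕ) : MeasurableSet (posOrthant d) := by
  rw [posOrthant_eq_pi]
  exact MeasurableSet.univ_pi fun _ => measurableSet_Ioi

theorem orthantVolume_eq_pi (d : ℕ) :
    orthantVolume d = Measure.pi fun _ => volume.restrict (Set.Ioi 0) := by
  rw [orthantVolume, posOrthant_eq_pi, volume_pi, Measure.restrict_pi_pi]

instance (d : ℕ) : SFinite (orthantVolume d) := by
  rw [orthantVolume]
  infer_instance

theorem ae_mem_posOrthant (d : ℕ) : ∀ᵐ x ∂(orthantVolume d), x ∈ posOrthant d :=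
  ae_restrict_mem (measurableSet_posOrthant d)

theorem integral_orthant_prod (f : Fin d → ℝ → ℝ) :
    ∫ x, ∏ i, f i (x i) ∂(orthantVolume d) = ∏ i, ∫ y in Set.Ioi 0, f i y := by
  rw [orthantVolume_eq_pi]
  exact integral_fintype_prod_eq_prod f

theorem integrable_orthant_prod {f : Fin d → ℝ → ℝ}
    (hf : ∀ i, Integrable (f i) (volume.restrict (Set.Ioi 0))) :
    Integrable (fun x => ∏ i, f i (x i)) (orthantVolume d) := by
  rw [orthantVolume_eq_pi]
  exact Integrable.fintype_prod hf

theorem memLp_two_orthant_prod {f : Fin d → ℝ → ℝ} (hm : ∀ i, Measurable (f i))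
    (hf : ∀ i, Integrable (fun x => f i x * f i x) (volume.restrict (Set.Ioi 0))) :
    MemLp (fun x => ∏ i, f i (x i)) 2 (orthantVolume d) := by
  have hmeas : Measurable fun x : Fin d → ℝ => ∏ i, f i (x i) :=
    Finset.measurable_prod _ fun i _ => (hm i).comp (measurable_pi_apply i)
  rw [memLp_two_iff_integrable_sq hmeas.aestronglyMeasurable]
  simp only [sq, ← Finset.prod_mul_distrib]
  exact integrable_orthant_prod hf

theorem memLp_laguerreFunPi (hβ : ∀ i, 0 ≤ β i) (k : Fin d → ℕ) :
    MemLp (laguerreFunPi β k) 2 (orthantVolume d) :=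
  memLp_two_orthant_prod (fun i => measurable_laguerreFun (β i) (k i))
    fun i => integrable_laguerreFun_mul (hβ i) (k i) (k i)

theorem integral_laguerreFunPi_mul (hβ : ∀ i, 0 ≤ β i) (k l : Fin d → ℕ) :
    ∫ x, laguerreFunPi β k x * laguerreFunPi β l x ∂(orthantVolume d) =
      if k = l then 1 else 0 := by
  simp only [laguerreFunPi, ← Finset.prod_mul_distrib]
  rw [integral_orthant_prod (f := fun i y => laguerreFun (β i) (k i) y * laguerreFun (β i) (l i) y)]
  simp only [integral_laguerreFun_mul (hβ _)]
  split_ifs with h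
  · subst h; simp
  · obtain ⟨i, hi⟩ := Function.ne_iff.1 h
    exact Finset.prod_eq_zero (Finset.mem_univ i) (if_neg hi)

theorem integral_laguerreMonomial_prod_mul_eq_zero (hβ : ∀ i, 0 ≤ β i) {g : (Fin d → ℝ) → ℝ}
    (hg : MemLp g 2 (orthantVolume d))
    (h : ∀ k, ∫ x, laguerreFunPi β k x * g x ∂(orthantVolume d) = 0) (n : Fin d → ℕ) :
    ∫ x, (∏ i, laguerreMonomial (β i) (n i) (x i)) * g x ∂(orthantVolume d) = 0 := by
  have hspan := fun i => Finsupp.mem_span_range_iff_exists_finsupp.1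
    (laguerreMonomial_mem_span (hβ i) (n i))
  choose c hc using hspan
  have e : ∀ x : Fin d → ℝ, ∏ i, laguerreMonomial (β i) (n i) (x i) =
      ∑ κ ∈ Fintype.piFinset fun i => (c i).support, (∏ i, c i (κ i)) * laguerreFunPi β κ x := by
    intro x
    simp only [laguerreFunPi, ← Finset.prod_mul_distrib]
    rw [← Finset.prod_univ_sum (t := fun i => (c i).support)
      (f := fun i k => c i k * laguerreFun (β i) k (x i))]
    refine Finset.prod_congr rfl fun i _ => ?_
    rw [← hc i, Finsupp.sum, Finset.sum_apply]
    simp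
  have hi : ∀ κ, Integrable (fun x => laguerreFunPi β κ x * g x) (orthantVolume d) := fun κ =>
    (memLp_laguerreFunPi hβ κ).integrable_mul hg
  simp only [e, Finset.sum_mul, mul_assoc]
  rw [integral_finsetSum _ fun κ _ => (hi κ).const_mul _]
  simp [integral_const_mul, h]

/-- Completeness of the Laguerre functions in real `L²`. -/
theorem ae_eq_zero_of_forall_integral_laguerreFunPi (hβ : ∀ i, 0 ≤ β i) {g : (Fin d → ℝ) → ℝ}
    (hg : MemLp g 2 (orthantVolume d))
    (h : ∀ k, ∫ x, laguerreFunPi β k x * g x ∂(orthantVolume d) = 0) :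
    g =ᵐ[orthantVolume d] 0 := by
  set W : (Fin d → ℝ) → ℝ := fun x => ∏ i, laguerreMonomial (β i) 0 (x i) with hW
  have hWm : Measurable W := Finset.measurable_prod _ fun i _ =>
    (measurable_laguerreMonomial (β i) 0).comp (measurable_pi_apply i)
  -- The rate 1/4 is below the decay rate 1/2 of the weight: in each coordinate the square is x^β
  -- e^(-x/2), still integrable.
  have hexp : MemLp (fun x : Fin d → ℝ =>
      ∏ i, (Real.exp (1 / 4 * |x i|) * laguerreMonomial (β i) 0 (x i))) 2 (orthantVolume d) := by
    refine memLp_two_orthant_prod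
      (f := fun i y => Real.exp (1 / 4 * |y|) * laguerreMonomial (β i) 0 y)
      (fun i => (by fun_prop : Measurable fun y : ℝ => Real.exp (1 / 4 * |y|)).mul
        (measurable_laguerreMonomial (β i) 0)) fun i => ?_
    have := integrableOn_rpow_mul_exp_neg_mul (c := β i) (p := 1 / 2)
      (by linarith [hβ i]) (by norm_num)
    refine this.congr_fun (fun y hy => ?_) measurableSet_Ioi
    have hy' : (0 : ℝ) < y := hy
    have e := laguerreMonomial_mul (β i) 0 0 hy'
    have e2 : Real.exp (-(1 / 2 * y)) =
        Real.exp (1 / 4 * |y|) * Real.exp (1 / 4 * |y|) * Real.exp (-(1 * y)) := by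
      rw [← Real.exp_add, ← Real.exp_add, abs_of_pos hy']
      ring_nf
    simp only [Nat.cast_zero, zero_add] at e
    beta_reduce
    rw [mul_mul_mul_comm, e, e2]
    ring
  have hint : Integrable (fun x : Fin d → ℝ => Real.exp (1 / 4 * ∑ i, |x i|) * (W x * g x))
      (orthantVolume d) := by
    refine (hexp.integrable_mul hg).congr (ae_of_all _ fun x => ?_)
    simp only [Pi.mul_apply, Finset.prod_mul_distrib, ← Real.exp_sum, ← Finset.mul_sum, hW,
      mul_assoc]
  have hz := ae_eq_zero_of_forall_moment_eq_zero (by norm_num) hint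
    (hWm.aestronglyMeasurable.mul hg.1) fun n => by
      rw [← integral_laguerreMonomial_prod_mul_eq_zero hβ hg h n]
      congr 1
      funext x
      simp only [hW]
      rw [← mul_assoc, ← Finset.prod_mul_distrib]
      congr 1
      refine Finset.prod_congr rfl fun i _ => ?_
      simp [laguerreMonomial]
  filter_upwards [hz, ae_mem_posOrthant d] with x hx hxp
  -- The moment theorem gives W g = 0; the weight is positive on the orthant and can be divided out.
  have hWx : 0 < W x := Finset.prod_pos fun i _ => by
    have := hxp i
    rw [laguerreMonomial]
    positivity
  simpa [hWx.ne'] using hx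

variable {𝕜 : Type*} [RCLike 𝕜]

/-- The Laguerre functions as elements of `L²`. -/
noncomputable def laguerreLp (𝕜 : Type*) [RCLike 𝕜] (hβ : ∀ i, 0 ≤ β i) (k : Fin d → ℕ) :
    Lp 𝕜 2 (orthantVolume d) :=
  ((memLp_laguerreFunPi hβ k).ofReal (K := 𝕜)).toLp

theorem coeFn_laguerreLp (hβ : ∀ i, 0 ≤ β i) (k : Fin d → ℕ) :
    laguerreLp 𝕜 hβ k =ᵐ[orthantVolume d] fun x => (laguerreFunPi β k x : 𝕜) :=
  MemLp.coeFn_toLp _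

theorem inner_laguerreLp (hβ : ∀ i, 0 ≤ β i) (k : Fin d → ℕ) (f : Lp 𝕜 2 (orthantVolume d)) :
    inner 𝕜 (laguerreLp 𝕜 hβ k) f = ∫ x, laguerreFunPi β k x • f x ∂(orthantVolume d) := by
  rw [L2.inner_def]
  refine integral_congr_ae ?_
  filter_upwards [coeFn_laguerreLp (𝕜 := 𝕜) hβ k] with x hx
  rw [hx, RCLike.inner_apply, RCLike.conj_ofReal, RCLike.real_smul_eq_coe_mul, mul_comm]

theorem inner_laguerreLp_toLp (hβ : ∀ i, 0 ≤ β i) (k : Fin d → ℕ) {f : (Fin d → ℝ) → 𝕜}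
    (hf : MemLp f 2 (orthantVolume d)) :
    inner 𝕜 (laguerreLp 𝕜 hβ k) (hf.toLp f) =
      ∫ x, laguerreFunPi β k x • f x ∂(orthantVolume d) := by
  rw [inner_laguerreLp]
  refine integral_congr_ae ?_
  filter_upwards [hf.coeFn_toLp] with x hx
  rw [hx]

theorem orthonormal_laguerreLp (hβ : ∀ i, 0 ≤ β i) : Orthonormal 𝕜 (laguerreLp 𝕜 hβ) := by
  rw [orthonormal_iff_ite]
  intro k l
  rw [laguerreLp.eq_1 𝕜 hβ l, inner_laguerreLp_toLp]
  simp only [RCLike.real_smul_eq_coe_mul, ← RCLike.ofReal_mul]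
  rw [integral_ofReal, integral_laguerreFunPi_mul hβ]
  split_ifs <;> simp

/-- The Laguerre functions are real, so real and imaginary parts of f are orthogonal to them
separately. -/
theorem span_laguerreLp_orthogonal (hβ : ∀ i, 0 ≤ β i) :
    (Submodule.span 𝕜 (Set.range (laguerreLp 𝕜 hβ)))ᗮ = ⊥ := by
  rw [Submodule.eq_bot_iff]
  intro f hf
  have hf2 := Lp.memLp f
  have hk : ∀ k, ∫ x, laguerreFunPi β k x • f x ∂(orthantVolume d) = 0 := fun k => by
    rw [← inner_laguerreLp hβ]
    exact (Submodule.mem_orthogonal _ _).1 hf _ (Submodule.subset_span ⟨k, rfl⟩)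
  have hi : ∀ k, Integrable (fun x => laguerreFunPi β k x • f x) (orthantVolume d) := fun k =>
    memLp_one_iff_integrable.1 (MemLp.smul (p := 2) (q := 2) (r := 1) hf2
      (memLp_laguerreFunPi hβ k))
  have hre := ae_eq_zero_of_forall_integral_laguerreFunPi hβ hf2.re fun k => by
    have := integral_re (hi k)
    simpa [hk k, RCLike.smul_re] using this
  have him := ae_eq_zero_of_forall_integral_laguerreFunPi hβ hf2.im fun k => by
    have := integral_im (hi k)
    simpa [hk k, RCLike.smul_im] using this
  rw [Lp.eq_zero_iff_ae_eq_zero]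
  filter_upwards [hre, him] with x h1 h2
  exact RCLike.ext (by simpa using h1) (by simpa using h2)

/-- The Laguerre functions form a Hilbert basis of `L²` of the orthant. -/
noncomputable def laguerreBasis (𝕜 : Type*) [RCLike 𝕜] (hβ : ∀ i, 0 ≤ β i) :
    HilbertBasis (Fin d → ℕ) 𝕜 (Lp 𝕜 2 (orthantVolume d)) :=
  HilbertBasis.mkOfOrthogonalEqBot (orthonormal_laguerreLp hβ) (span_laguerreLp_orthogonal hβ)

theorem laguerreBasis_apply (hβ : ∀ i, 0 ≤ β i) (k : Fin d → ℕ) :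
    laguerreBasis 𝕜 hβ k = laguerreLp 𝕜 hβ k := by
  rw [laguerreBasis, HilbertBasis.coe_mkOfOrthogonalEqBot]

theorem laguerreBasis_repr_toLp (hβ : ∀ i, 0 ≤ β i) (k : Fin d → ℕ) {f : (Fin d → ℝ) → 𝕜}
    (hf : MemLp f 2 (orthantVolume d)) :
    (laguerreBasis 𝕜 hβ).repr (hf.toLp f) k =
      ∫ x, laguerreFunPi β k x • f x ∂(orthantVolume d) := by
  rw [HilbertBasis.repr_apply_apply, laguerreBasis_apply, inner_laguerreLp_toLp]

/-- The multi-indices of length less than `N`. -/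
def multiIndexLT (d N : ℕ) : Finset (Fin d → ℕ) :=
  (Finset.range N).biUnion fun n => Finset.piAntidiag Finset.univ n

theorem sum_multiIndexLT {M : Type*} [AddCommMonoid M] (N : ℕ) (F : (Fin d → ℕ) → M) :
    ∑ k ∈ multiIndexLT d N, F k =
      ∑ n ∈ Finset.range N, ∑ k ∈ Finset.piAntidiag Finset.univ n, F k := by
  refine Finset.sum_biUnion fun m _ n _ hmn => ?_
  refine Finset.disjoint_left.2 fun k hk hk' => hmn ?_
  rw [Finset.mem_piAntidiag] at hk hk'
  exact hk.1.symm.trans hk'.1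

/-- Lets an unconditional sum over multi-indices be evaluated by increasing length, the order used
in the heat kernel series. -/
theorem tendsto_multiIndexLT (d : ℕ) : Tendsto (multiIndexLT d) atTop atTop := by
  refine tendsto_atTop_finset_of_monotone (fun M N h => ?_) fun k => ⟨∑ i, k i + 1, ?_⟩
  · exact Finset.biUnion_subset_biUnion_of_subset_left _ (Finset.range_subset_range.2 h)
  · simp only [multiIndexLT, Finset.mem_biUnion, Finset.mem_range, Finset.mem_piAntidiag]
    exact ⟨∑ i, k i, Nat.lt_succ_self _, rfl, fun i _ => Finset.mem_univ i⟩

theorem coeFn_sum_smul_laguerreLp (hβ : ∀ i, 0 ≤ β i) (c : (Fin d → ℕ) → 𝕜)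
    (s : Finset (Fin d → ℕ)) :
    ((∑ k ∈ s, c k • laguerreLp 𝕜 hβ k : Lp 𝕜 2 (orthantVolume d)) : (Fin d → ℝ) → 𝕜)
      =ᵐ[orthantVolume d] fun x => ∑ k ∈ s, laguerreFunPi β k x • c k := by
  induction s using Finset.cons_induction with
  | empty =>
    simp only [Finset.sum_empty]
    exact Lp.coeFn_zero _ _ _
  | cons k s hk ih =>
    rw [Finset.sum_cons]
    filter_upwards [ih, Lp.coeFn_add (c k • laguerreLp 𝕜 hβ k) (∑ k ∈ s, c k • laguerreLp 𝕜 hβ k),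
      Lp.coeFn_smul (c k) (laguerreLp 𝕜 hβ k), coeFn_laguerreLp (𝕜 := 𝕜) hβ k] with x h1 h2 h3 h4
    rw [h2, Pi.add_apply, h1, h3, Pi.smul_apply, h4, Finset.sum_cons, smul_eq_mul,
      RCLike.real_smul_eq_coe_mul, mul_comm]

/-- The Laguerre expansion of an `L²` function converges to it. -/
theorem tendsto_eLpNorm_sub_laguerre_sum (hβ : ∀ i, 0 ≤ β i) {f : (Fin d → ℝ) → 𝕜}
    (hf : MemLp f 2 (orthantVolume d)) :
    Tendsto (fun N => eLpNorm (f - fun x => ∑ k ∈ multiIndexLT d N, laguerreFunPi β k x •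
        ∫ y, laguerreFunPi β k y • f y ∂(orthantVolume d)) 2 (orthantVolume d)) atTop (𝓝 0) := by
  have h := ((laguerreBasis 𝕜 hβ).hasSum_repr (hf.toLp f)).comp (tendsto_multiIndexLT d)
  have h2 := (tendsto_const_nhds (x := hf.toLp f)).sub h
  rw [sub_self] at h2
  have h3 := h2.enorm
  rw [enorm_zero] at h3
  refine h3.congr fun N => ?_
  rw [Lp.enorm_def]
  refine eLpNorm_congr_ae ?_
  simp only [Function.comp_apply, laguerreBasis_repr_toLp, laguerreBasis_apply]
  filter_upwards [Lp.coeFn_sub (hf.toLp f) (∑ k ∈ multiIndexLT d N,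
    (∫ y, laguerreFunPi β k y • f y ∂(orthantVolume d)) • laguerreLp 𝕜 hβ k), hf.coeFn_toLp,
    coeFn_sum_smul_laguerreLp hβ (fun k => ∫ y, laguerreFunPi β k y • f y ∂(orthantVolume d))
      (multiIndexLT d N)] with x h1 h2 h3
  rw [h1, Pi.sub_apply, h2, h3, Pi.sub_apply]

end LaguerreBasis

/-! ### The multi-dimensional heat kernel in closed form -/

section HeatKernel

variable {d : ℕ} {β : Fin d → ℝ} {t : ℝ}

/-- The closed form of the Laguerre heat kernel, extended by zero off the orthant. -/
noncomputable def laguerreHeatKernel (β : Fin d → ℝ) (t : ℝ) (x y : Fin d → ℝ) : ℝ :=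
  (posOrthant d ×ˢ posOrthant d).indicator
    (fun p => ∏ i, hilleHardyKernel (β i) (Real.exp (-t)) (p.1 i) (p.2 i)) (x, y)

theorem laguerreHeatKernel_of_mem (β : Fin d → ℝ) (t : ℝ) {x y : Fin d → ℝ}
    (hx : x ∈ posOrthant d) (hy : y ∈ posOrthant d) : laguerreHeatKernel β t x y =
      ∏ i, hilleHardyKernel (β i) (Real.exp (-t)) (x i) (y i) :=
  Set.indicator_of_mem (s := posOrthant d ×ˢ posOrthant d) ⟨hx, hy⟩ _

theorem laguerreHeatKernel_of_notMem (β : Fin d → ℝ) (t : ℝ) {x y : Fin d → ℝ}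
    (h : ¬(x ∈ posOrthant d ∧ y ∈ posOrthant d)) : laguerreHeatKernel β t x y = 0 :=
  Set.indicator_of_notMem (s := posOrthant d ×ˢ posOrthant d) h _

theorem exists_isDominatedKernel_laguerreHeatKernel (hβ : ∀ i, 0 ≤ β i) (ht : 0 < t) :
    ∃ Φ, IsDominatedKernel (orthantVolume d) (laguerreHeatKernel β t) Φ := by
  have hr : 0 < Real.exp (-t) := Real.exp_pos _
  have hr1 : Real.exp (-t) < 1 := Real.exp_lt_one_iff.2 (by linarith)
  choose C δ hC hδ hle using fun i => exists_hilleHardyKernel_le (hβ i) hr hr1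
  choose D hD hDle using fun i =>
    exists_rpow_mul_exp_neg_le (s := β i / 2) (by linarith [hβ i]) (hδ i)
  -- The square root distributes the constant evenly, so that Φ ⊗ Φ carries the full C i.
  set φ : Fin d → ℝ → ℝ := fun i y => √(C i) * (y ^ (β i / 2) * Real.exp (-(δ i * y))) with hφ
  have hφm : Measurable fun x : Fin d → ℝ => ∏ i, φ i (x i) :=
    Finset.measurable_prod _ fun i _ => by
      simp only [hφ]
      fun_prop
  have hφ0 : ∀ i y, 0 < y → 0 ≤ φ i y := fun i y hy => by
    simp only [hφ]
    positivity
  set Φ := (posOrthant d).indicator fun x => ∏ i, φ i (x i) with hΦ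
  have hΦ0 : ∀ x, 0 ≤ Φ x := fun x => Set.indicator_nonneg
    (fun x (hx : x ∈ posOrthant d) => Finset.prod_nonneg fun i _ => hφ0 i _ (hx i)) x
  refine ⟨Φ, ?_, fun x y => ?_, fun x y => ?_, fun x y => ?_, ?_, hΦ0, ?_, ∏ i, (√(C i) * D i),
    fun x => ?_⟩
  · refine Measurable.indicator (Finset.measurable_prod _ fun i _ => ?_)
      ((measurableSet_posOrthant d).prod (measurableSet_posOrthant d))
    exact (measurable_hilleHardyKernel (hβ i) _).comp
      (f := fun p : (Fin d → ℝ) × (Fin d → ℝ) => (p.1 i, p.2 i)) (by fun_prop)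
  · exact Set.indicator_nonneg (fun p hp => Finset.prod_nonneg fun i _ =>
      hilleHardyKernel_nonneg (hβ i) hr hr1 (hp.1 i) (hp.2 i)) _
  · by_cases h : x ∈ posOrthant d ∧ y ∈ posOrthant d
    · rw [laguerreHeatKernel_of_mem β t h.1 h.2, laguerreHeatKernel_of_mem β t h.2 h.1]
      simp only [hilleHardyKernel_comm]
    · rw [laguerreHeatKernel_of_notMem β t h, laguerreHeatKernel_of_notMem β t (by tauto)]
  · by_cases h : x ∈ posOrthant d ∧ y ∈ posOrthant d
    · rw [laguerreHeatKernel_of_mem β t h.1 h.2, hΦ, Set.indicator_of_mem h.1,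
        Set.indicator_of_mem h.2, ← Finset.prod_mul_distrib]
      refine Finset.prod_le_prod
        (fun i _ => hilleHardyKernel_nonneg (hβ i) hr hr1 (h.1 i) (h.2 i)) fun i _ => ?_
      refine (hle i _ _ (h.1 i) (h.2 i)).trans (le_of_eq ?_)
      have := Real.mul_self_sqrt (hC i).le
      simp only [hφ]
      nth_rw 1 [← this]
      ring
    · rw [laguerreHeatKernel_of_notMem β t h]
      exact mul_nonneg (hΦ0 x) (hΦ0 y)
  · exact hφm.indicator (measurableSet_posOrthant d)
  · refine (integrable_orthant_prod (f := φ) fun i => ?_).indicator (measurableSet_posOrthant d)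
    exact (integrableOn_rpow_mul_exp_neg_mul (by linarith [hβ i]) (hδ i)).const_mul _
  · by_cases hx : x ∈ posOrthant d
    · rw [hΦ, Set.indicator_of_mem hx]
      refine Finset.prod_le_prod (fun i _ => hφ0 i _ (hx i)) fun i _ => ?_
      simp only [hφ]
      gcongr
      exact hDle i _ (hx i)
    · rw [hΦ, Set.indicator_of_notMem hx]
      exact Finset.prod_nonneg fun i _ => by have := hD i; positivity

theorem two_mul_sqrt_exp_div_eq (t : ℝ) :
    2 * √(Real.exp (-t)) / (1 + Real.exp (-t)) = (Real.cosh (t / 2))⁻¹ := by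
  have e1 : Real.exp (-t) = Real.exp (-(t / 2)) * Real.exp (-(t / 2)) := by
    rw [← Real.exp_add]; ring_nf
  have e2 : Real.exp (t / 2) * Real.exp (-(t / 2)) = 1 := by
    rw [← Real.exp_add]; simp
  have h1 := Real.exp_pos (t / 2)
  have h2 := Real.exp_pos (-(t / 2))
  rw [e1, Real.sqrt_mul_self h2.le, Real.cosh_eq, inv_div, div_eq_div_iff (by positivity)
    (by positivity)]
  linear_combination 2 * e2

theorem integral_laguerreHeatKernel_le (hβ : ∀ i, 0 ≤ β i) (ht : 0 < t) (x : Fin d → ℝ) :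
    ∫ y, laguerreHeatKernel β t x y ∂(orthantVolume d) ≤ (Real.cosh (t / 2) ^ d)⁻¹ := by
  have hr : 0 < Real.exp (-t) := Real.exp_pos _
  have hr1 : Real.exp (-t) < 1 := Real.exp_lt_one_iff.2 (by linarith)
  by_cases hx : x ∈ posOrthant d
  · have e : ∫ y, laguerreHeatKernel β t x y ∂(orthantVolume d) =
        ∏ i, ∫ y in Set.Ioi 0, hilleHardyKernel (β i) (Real.exp (-t)) (x i) y := by
      rw [← integral_orthant_prod]
      refine integral_congr_ae ?_
      filter_upwards [ae_mem_posOrthant d] with y hy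
      exact laguerreHeatKernel_of_mem β t hx hy
    rw [e]
    calc _ ≤ ∏ _i : Fin d, (Real.cosh (t / 2))⁻¹ := by
          refine Finset.prod_le_prod (fun i _ => setIntegral_nonneg measurableSet_Ioi fun y hy =>
            hilleHardyKernel_nonneg (hβ i) hr hr1 (hx i) hy) fun i _ => ?_
          rw [← two_mul_sqrt_exp_div_eq]
          exact integral_hilleHardyKernel_le (hβ i) hr hr1 (hx i)
      _ = _ := by simp
  · have : ∀ y, laguerreHeatKernel β t x y = 0 := fun y =>
      laguerreHeatKernel_of_notMem β t (by tauto)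
    simp only [this, integral_zero]
    have := Real.cosh_pos (t / 2)
    positivity

theorem integral_laguerreHeatKernel_mul_laguerreFunPi (hβ : ∀ i, 0 ≤ β i) (ht : 0 < t)
    {x : Fin d → ℝ} (hx : x ∈ posOrthant d) (k : Fin d → ℕ) :
    ∫ y, laguerreHeatKernel β t x y * laguerreFunPi β k y ∂(orthantVolume d) =
      Real.exp (-t * laguerreEigenvalue β (∑ i, k i)) * laguerreFunPi β k x := by
  have hr : 0 < Real.exp (-t) := Real.exp_pos _
  have hr1 : Real.exp (-t) < 1 := Real.exp_lt_one_iff.2 (by linarith)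
  have e : ∫ y, laguerreHeatKernel β t x y * laguerreFunPi β k y ∂(orthantVolume d) =
      ∏ i, ∫ y in Set.Ioi 0, hilleHardyKernel (β i) (Real.exp (-t)) (x i) y *
        laguerreFun (β i) (k i) y := by
    rw [← integral_orthant_prod]
    refine integral_congr_ae ?_
    filter_upwards [ae_mem_posOrthant d] with y hy
    rw [laguerreHeatKernel_of_mem β t hx hy, laguerreFunPi, ← Finset.prod_mul_distrib]
  rw [e, Finset.prod_congr rfl fun i _ =>
    integral_hilleHardyKernel_mul_laguerreFun (hβ i) hr hr1 (hx i) (k i),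
    Finset.prod_mul_distrib, laguerreFunPi]
  congr 1
  have e2 : ∀ i, Real.exp (-t) ^ ((β i + 1) / 2) * Real.exp (-t) ^ k i =
      Real.exp (-t * ((k i : ℝ) + (β i + 1) / 2)) := fun i => by
    rw [← Real.exp_mul, ← Real.exp_nat_mul, ← Real.exp_add]
    ring_nf
  rw [Finset.prod_congr rfl fun i _ => e2 i, ← Real.exp_sum, ← Finset.mul_sum,
    Finset.sum_add_distrib, ← Finset.sum_div, Finset.sum_add_distrib, laguerreEigenvalue]
  simp

/-- The coefficients of the bilinear expansion of the heat kernel. -/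
theorem hasSum_laguerreHeatKernel_mul (hβ : ∀ i, 0 ≤ β i) {s : ℝ} (hs : 0 < s) (ht : 0 < t)
    {x y : Fin d → ℝ} (hx : x ∈ posOrthant d) (hy : y ∈ posOrthant d) :
    HasSum (fun k : Fin d → ℕ => Real.exp (-(s + t) * laguerreEigenvalue β (∑ i, k i)) *
        (laguerreFunPi β k x * laguerreFunPi β k y))
      (∫ z, laguerreHeatKernel β s x z * laguerreHeatKernel β t z y ∂(orthantVolume d)) := by
  obtain ⟨Φ, hΦ⟩ := exists_isDominatedKernel_laguerreHeatKernel hβ hs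
  obtain ⟨Ψ, hΨ⟩ := exists_isDominatedKernel_laguerreHeatKernel hβ ht
  have hmx := hΦ.memLp_right x 2 one_le_two
  have hmy := hΨ.memLp_right y 2 one_le_two
  -- Parseval for the sections at x and y, whose coefficients are known from the eigenfunction
  -- identity.
  have h := (laguerreBasis ℝ hβ).hasSum_inner_mul_inner (hmx.toLp _) (hmy.toLp _)
  have hv : inner ℝ (hmx.toLp _) (hmy.toLp _) =
      ∫ z, laguerreHeatKernel β s x z * laguerreHeatKernel β t z y ∂(orthantVolume d) := by
    rw [L2.inner_def]
    refine integral_congr_ae ?_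
    filter_upwards [hmx.coeFn_toLp, hmy.coeFn_toLp] with z h1 h2
    rw [h1, h2, hΨ.comm z y, real_inner_eq_re_inner, RCLike.inner_apply]
    simp [mul_comm]
  rw [hv] at h
  refine h.congr_fun fun k => ?_
  rw [real_inner_comm, laguerreBasis_apply, inner_laguerreLp_toLp, inner_laguerreLp_toLp]
  simp only [smul_eq_mul, mul_comm (laguerreFunPi β k _) (laguerreHeatKernel _ _ _ _)]
  rw [integral_laguerreHeatKernel_mul_laguerreFunPi hβ hs hx,
    integral_laguerreHeatKernel_mul_laguerreFunPi hβ ht hy, neg_add, add_mul, Real.exp_add]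
  ring

theorem laguerreKernelTerm_eq_sum (β : Fin d → ℝ) (t : ℝ) (x y : Fin d → ℝ) (n : ℕ) :
    laguerreKernelTerm β t x y n = ∑ k ∈ Finset.piAntidiag Finset.univ n,
      Real.exp (-t * laguerreEigenvalue β (∑ i, k i)) *
        (laguerreFunPi β k x * laguerreFunPi β k y) := by
  rw [laguerreKernelTerm, Finset.mul_sum]
  refine Finset.sum_congr rfl fun k hk => ?_
  rw [(Finset.mem_piAntidiag.1 hk).1]

theorem summable_laguerreKernel_multiIndex (hβ : ∀ i, 0 ≤ β i) (ht : 0 < t)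
    {x y : Fin d → ℝ} (hx : x ∈ posOrthant d) (hy : y ∈ posOrthant d) :
    Summable fun k : Fin d → ℕ => Real.exp (-t * laguerreEigenvalue β (∑ i, k i)) *
        (laguerreFunPi β k x * laguerreFunPi β k y) := by
  have := (hasSum_laguerreHeatKernel_mul hβ (half_pos ht) (half_pos ht) hx hy).summable
  rwa [add_halves] at this

theorem summable_laguerreKernelTerm (hβ : ∀ i, 0 ≤ β i) (ht : 0 < t)
    {x y : Fin d → ℝ} (hx : x ∈ posOrthant d) (hy : y ∈ posOrthant d) :
    Summable (laguerreKernelTerm β t x y) := by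
  have hs := (summable_laguerreKernel_multiIndex hβ ht hx hy).norm
  refine Summable.of_norm (summable_of_sum_range_le (c := ∑' k : Fin d → ℕ,
    ‖Real.exp (-t * laguerreEigenvalue β (∑ i, k i)) *
      (laguerreFunPi β k x * laguerreFunPi β k y)‖) (fun _ => norm_nonneg _) fun N => ?_)
  refine le_trans (Finset.sum_le_sum fun n _ => ?_) (le_trans (sum_multiIndexLT N _).ge
    (hs.sum_le_tsum (multiIndexLT d N) fun _ _ => norm_nonneg _))
  rw [laguerreKernelTerm_eq_sum]
  exact norm_sum_le _ _

theorem laguerreKernel_eq_tsum_multiIndex (hβ : ∀ i, 0 ≤ β i) (ht : 0 < t)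
    {x y : Fin d → ℝ} (hx : x ∈ posOrthant d) (hy : y ∈ posOrthant d) :
    laguerreKernel β t x y = ∑' k : Fin d → ℕ,
      Real.exp (-t * laguerreEigenvalue β (∑ i, k i)) *
        (laguerreFunPi β k x * laguerreFunPi β k y) := by
  have h1 := (summable_laguerreKernel_multiIndex hβ ht hx hy).hasSum.comp (tendsto_multiIndexLT d)
  have h2 := (summable_laguerreKernelTerm hβ ht hx hy).hasSum.tendsto_sum_nat
  refine tendsto_nhds_unique h2 (h1.congr fun N => ?_)
  simp only [Function.comp_apply, sum_multiIndexLT, laguerreKernelTerm_eq_sum]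

theorem laguerreKernel_add_eq_integral (hβ : ∀ i, 0 ≤ β i) {s : ℝ} (hs : 0 < s) (ht : 0 < t)
    {x y : Fin d → ℝ} (hx : x ∈ posOrthant d) (hy : y ∈ posOrthant d) :
    laguerreKernel β (s + t) x y =
      ∫ z, laguerreHeatKernel β s x z * laguerreHeatKernel β t z y ∂(orthantVolume d) := by
  rw [laguerreKernel_eq_tsum_multiIndex hβ (add_pos hs ht) hx hy]
  exact (hasSum_laguerreHeatKernel_mul hβ hs ht hx hy).tsum_eq

/-- The Hille-Hardy formula. -/
theorem laguerreKernel_ae_eq (hβ : ∀ i, 0 ≤ β i) (ht : 0 < t) {x : Fin d → ℝ}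
    (hx : x ∈ posOrthant d) :
    laguerreKernel β t x =ᵐ[orthantVolume d] laguerreHeatKernel β t x := by
  obtain ⟨Φ, hΦ⟩ := exists_isDominatedKernel_laguerreHeatKernel hβ ht
  have hm := hΦ.memLp_right x 2 one_le_two
  have h := tendsto_eLpNorm_sub_laguerre_sum hβ hm
  simp only [smul_eq_mul, mul_comm (laguerreFunPi β _ _) (laguerreHeatKernel _ _ _ _),
    integral_laguerreHeatKernel_mul_laguerreFunPi hβ ht hx] at h
  simp only [eLpNorm_sub_comm (laguerreHeatKernel β t x)] at h
  -- The expansion of the section at x converges to it in L², hence almost everywhere along a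
  -- subsequence. The series also converges at every point of the orthant, so the two limits agree
  -- for almost every y.
  have hmeas := tendstoInMeasure_of_tendsto_eLpNorm two_ne_zero (fun N => by
    refine (Measurable.aestronglyMeasurable ?_)
    refine Finset.measurable_sum _ fun k _ => Measurable.mul_const ?_ _
    exact Finset.measurable_prod _ fun i _ =>
      (measurable_laguerreFun (β i) (k i)).comp (measurable_pi_apply i)) hm.1 h
  obtain ⟨ns, hns, hae⟩ := hmeas.exists_seq_tendsto_ae
  filter_upwards [hae, ae_mem_posOrthant d] with y h1 hy
  have h2 := ((summable_laguerreKernel_multiIndex hβ ht hx hy).hasSum.comp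
    (tendsto_multiIndexLT d)).comp hns.tendsto_atTop
  rw [← laguerreKernel_eq_tsum_multiIndex hβ ht hx hy] at h2
  refine tendsto_nhds_unique h2 (h1.congr fun N => Finset.sum_congr rfl fun k _ => ?_)
  ring

/-- The Chapman-Kolmogorov equation, without any Bessel integral: both sides are the Laguerre series
at time s + t. -/
theorem integral_laguerreHeatKernel_mul_ae_eq (hβ : ∀ i, 0 ≤ β i) {s : ℝ} (hs : 0 < s)
    (ht : 0 < t) {x : Fin d → ℝ} (hx : x ∈ posOrthant d) :
    (fun y => ∫ z, laguerreHeatKernel β s x z * laguerreHeatKernel β t z y ∂(orthantVolume d))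
      =ᵐ[orthantVolume d] laguerreHeatKernel β (s + t) x := by
  filter_upwards [laguerreKernel_ae_eq hβ (add_pos hs ht) hx, ae_mem_posOrthant d] with y h hy
  rw [← h, laguerreKernel_add_eq_integral hβ hs ht hx hy]

end HeatKernel

/-! ### The modified semigroup -/

section ModifiedKernel

variable {d : ℕ} {β : Fin d → ℝ} {t : ℝ} {𝕜 : Type*} [RCLike 𝕜]

/-- The kernel of the modified semigroup. -/
noncomputable def modifiedHeatKernel (β : Fin d → ℝ) (t : ℝ) (x y : Fin d → ℝ) : ℝ :=
  Real.exp (-t / 2) * laguerreHeatKernel β t x y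

theorem exists_isDominatedKernel_modifiedHeatKernel (hβ : ∀ i, 0 ≤ β i) (ht : 0 < t) :
    ∃ Φ, IsDominatedKernel (orthantVolume d) (modifiedHeatKernel β t) Φ := by
  obtain ⟨Φ, hΦ⟩ := exists_isDominatedKernel_laguerreHeatKernel hβ ht
  refine ⟨Φ, hΦ.measurable.const_mul _, fun x y => mul_nonneg (Real.exp_pos _).le (hΦ.nonneg x y),
    fun x y => by rw [modifiedHeatKernel, hΦ.comm, modifiedHeatKernel], fun x y => ?_,
    hΦ.measurable_bound, hΦ.bound_nonneg, hΦ.integrable_bound, hΦ.bounded⟩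
  refine le_trans (mul_le_of_le_one_left (hΦ.nonneg x y) ?_) (hΦ.le x y)
  exact Real.exp_le_one_iff.2 (by linarith)

/-- The bound for the operator norms. -/
noncomputable def modifiedNormBound (d : ℕ) (t : ℝ) : ℝ :=
  Real.exp (-t / 2) * (Real.cosh (t / 2) ^ d)⁻¹

theorem modifiedNormBound_lt_one (d : ℕ) (ht : 0 < t) : modifiedNormBound d t < 1 := by
  have h1 : Real.exp (-t / 2) < 1 := Real.exp_lt_one_iff.2 (by linarith)
  have h2 : (Real.cosh (t / 2) ^ d)⁻¹ ≤ 1 :=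
    inv_le_one_of_one_le₀ (one_le_pow₀ (Real.one_le_cosh _))
  calc modifiedNormBound d t ≤ Real.exp (-t / 2) * 1 := by
        rw [modifiedNormBound]
        gcongr
    _ < 1 := by rwa [mul_one]

theorem integral_modifiedHeatKernel_le (hβ : ∀ i, 0 ≤ β i) (ht : 0 < t) (x : Fin d → ℝ) :
    ∫ y, modifiedHeatKernel β t x y ∂(orthantVolume d) ≤ modifiedNormBound d t := by
  simp only [modifiedHeatKernel, modifiedNormBound]
  rw [integral_const_mul]
  gcongr
  exact integral_laguerreHeatKernel_le hβ ht x

theorem integral_modifiedHeatKernel_mul_laguerreFunPi (hβ : ∀ i, 0 ≤ β i) (ht : 0 < t)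
    {x : Fin d → ℝ} (hx : x ∈ posOrthant d) (k : Fin d → ℕ) :
    ∫ y, modifiedHeatKernel β t x y * laguerreFunPi β k y ∂(orthantVolume d) =
      Real.exp (-t * (laguerreEigenvalue β (∑ i, k i) + 1 / 2)) * laguerreFunPi β k x := by
  simp only [modifiedHeatKernel, mul_assoc]
  rw [integral_const_mul, integral_laguerreHeatKernel_mul_laguerreFunPi hβ ht hx, ← mul_assoc,
    ← Real.exp_add]
  ring_nf

theorem kernelOp_modifiedHeatKernel_add (hβ : ∀ i, 0 ≤ β i) {s : ℝ} (hs : 0 < s) (ht : 0 < t)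
    {f : (Fin d → ℝ) → 𝕜} (hf : f ∈ LOneAddLInfty 𝕜 (orthantVolume d)) {x : Fin d → ℝ}
    (hx : x ∈ posOrthant d) :
    kernelOp (orthantVolume d) (modifiedHeatKernel β s)
        (kernelOp (orthantVolume d) (modifiedHeatKernel β t) f) x =
      kernelOp (orthantVolume d) (modifiedHeatKernel β (s + t)) f x := by
  obtain ⟨Φ, hΦ⟩ := exists_isDominatedKernel_modifiedHeatKernel hβ hs
  obtain ⟨Ψ, hΨ⟩ := exists_isDominatedKernel_modifiedHeatKernel hβ ht
  rw [hΦ.kernelOp_kernelOp hΨ hf]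
  refine integral_congr_ae ?_
  filter_upwards [integral_laguerreHeatKernel_mul_ae_eq hβ hs ht hx] with y hy
  have e : ∀ z, modifiedHeatKernel β s x z * modifiedHeatKernel β t z y =
      Real.exp (-(s + t) / 2) * (laguerreHeatKernel β s x z * laguerreHeatKernel β t z y) := by
    intro z
    rw [modifiedHeatKernel, modifiedHeatKernel, mul_mul_mul_comm, ← Real.exp_add]
    ring_nf
  simp only [e]
  rw [integral_const_mul, hy, modifiedHeatKernel]

/-- The Laguerre coefficients of `T_t f`. -/
theorem integral_laguerreFunPi_smul_kernelOp (hβ : ∀ i, 0 ≤ β i) (ht : 0 < t)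
    {f : (Fin d → ℝ) → 𝕜} (hf : f ∈ LOneAddLInfty 𝕜 (orthantVolume d)) (k : Fin d → ℕ) :
    ∫ x, laguerreFunPi β k x • kernelOp (orthantVolume d) (modifiedHeatKernel β t) f x
        ∂(orthantVolume d) =
      Real.exp (-t * (laguerreEigenvalue β (∑ i, k i) + 1 / 2)) •
        ∫ x, laguerreFunPi β k x • f x ∂(orthantVolume d) := by
  obtain ⟨Φ, hΦ⟩ := exists_isDominatedKernel_modifiedHeatKernel hβ ht
  have hk := mem_LOneAddLInfty_of_memLp (𝕜 := 𝕜) one_le_two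
    ((memLp_laguerreFunPi hβ k).ofReal (K := 𝕜))
  have h := hΦ.integral_kernelOp_mul hk hf
  simp only [← RCLike.real_smul_eq_coe_mul] at h
  rw [← h, ← integral_smul]
  refine integral_congr_ae ?_
  filter_upwards [ae_mem_posOrthant d] with x hx
  rw [kernelOp_ofReal]
  simp only [kernelOp, smul_eq_mul]
  rw [integral_modifiedHeatKernel_mul_laguerreFunPi hβ ht hx, RCLike.ofReal_mul, mul_assoc,
    RCLike.real_smul_eq_coe_mul, RCLike.real_smul_eq_coe_mul]

end ModifiedKernel

/-! ### The semigroup axioms and the norm bound for `modifiedLaguerre` -/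

section Semigroup

variable {d : ℕ} {𝕜 : Type*} [RCLike 𝕜] {α : Fin d → ℝ} {j : Fin d}

/-- The only use of the hypotheses on α. -/
theorem shiftOrder_nonneg (hj : -1 ≤ α j) (hi : ∀ i, i ≠ j → 0 ≤ α i) (i : Fin d) :
    0 ≤ shiftOrder α j i := by
  rcases eq_or_ne i j with rfl | h
  · simp only [shiftOrder, Pi.add_apply, Pi.single_eq_same]
    linarith
  · simp [shiftOrder, h, hi i h]

variable (hβ : ∀ i, 0 ≤ shiftOrder α j i)
include hβ

/-- The exceptional set of the Hille-Hardy formula lies in y only, so the identity holds at every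
point x of the orthant. -/
theorem modifiedLaguerre_apply {t : ℝ≥0} (ht : 0 < t) (f : (Fin d → ℝ) → 𝕜) {x : Fin d → ℝ}
    (hx : x ∈ posOrthant d) : modifiedLaguerre α j t f x =
      kernelOp (orthantVolume d) (modifiedHeatKernel (shiftOrder α j) t) f x := by
  have ht' := NNReal.coe_pos.2 ht
  rw [modifiedLaguerre, if_neg ht.ne']
  simp only [kernelOp, modifiedHeatKernel, mul_smul]
  rw [integral_smul]
  congr 1
  refine integral_congr_ae ?_
  filter_upwards [laguerreKernel_ae_eq hβ ht' hx] with y hy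
  rw [hy]

theorem modifiedLaguerre_ae_eq {t : ℝ≥0} (ht : 0 < t) (f : (Fin d → ℝ) → 𝕜) :
    modifiedLaguerre α j t f =ᵐ[orthantVolume d]
      kernelOp (orthantVolume d) (modifiedHeatKernel (shiftOrder α j) t) f := by
  filter_upwards [ae_mem_posOrthant d] with x hx using modifiedLaguerre_apply hβ ht f hx

omit hβ in
theorem modifiedLaguerre_zero (f : (Fin d → ℝ) → 𝕜) : modifiedLaguerre α j 0 f = f :=
  if_pos rfl

theorem eLpNorm_modifiedLaguerre_le {t : ℝ≥0} (ht : 0 < t) {p : ℝ≥0∞} (hp : 1 ≤ p)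
    {f : (Fin d → ℝ) → 𝕜} (hf : AEStronglyMeasurable f (orthantVolume d)) :
    eLpNorm (modifiedLaguerre α j t f) p (orthantVolume d) ≤
      ENNReal.ofReal (modifiedNormBound d t) * eLpNorm f p (orthantVolume d) := by
  have ht' := NNReal.coe_pos.2 ht
  obtain ⟨Φ, hΦ⟩ := exists_isDominatedKernel_modifiedHeatKernel hβ ht'
  rw [eLpNorm_congr_ae (modifiedLaguerre_ae_eq hβ ht f)]
  exact hΦ.eLpNorm_kernelOp_le (integral_modifiedHeatKernel_le hβ ht') hp hf

theorem lpOpNorm_modifiedLaguerre_le {t : ℝ≥0} (ht : 0 < t) {p : ℝ≥0∞} (hp : 1 ≤ p) :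
    lpOpNorm (orthantVolume d) p (modifiedLaguerre (𝕜 := 𝕜) α j t) ≤
      ENNReal.ofReal (modifiedNormBound d t) := by
  refine iSup_le fun f => (eLpNorm_modifiedLaguerre_le hβ ht hp f.2.1.1).trans ?_
  exact (mul_le_mul_right f.2.2 _).trans (mul_one _).le

theorem memLp_modifiedLaguerre (t : ℝ≥0) {p : ℝ≥0∞} (hp : 1 ≤ p) {f : (Fin d → ℝ) → 𝕜}
    (hf : MemLp f p (orthantVolume d)) :
    MemLp (modifiedLaguerre α j t f) p (orthantVolume d) := by
  rcases eq_zero_or_pos t with rfl | ht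
  · rwa [modifiedLaguerre_zero]
  have ht' := NNReal.coe_pos.2 ht
  obtain ⟨Φ, hΦ⟩ := exists_isDominatedKernel_modifiedHeatKernel hβ ht'
  exact (hΦ.memLp_kernelOp (integral_modifiedHeatKernel_le hβ ht') hp hf).ae_eq
    (modifiedLaguerre_ae_eq hβ ht f).symm

theorem integral_laguerreFunPi_smul_modifiedLaguerre (t : ℝ≥0) {f : (Fin d → ℝ) → 𝕜}
    (hf : f ∈ LOneAddLInfty 𝕜 (orthantVolume d)) (k : Fin d → ℕ) :
    ∫ x, laguerreFunPi (shiftOrder α j) k x • modifiedLaguerre α j t f x ∂(orthantVolume d) =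
      Real.exp (-(t : ℝ) * (laguerreEigenvalue (shiftOrder α j) (∑ i, k i) + 1 / 2)) •
        ∫ x, laguerreFunPi (shiftOrder α j) k x • f x ∂(orthantVolume d) := by
  rcases eq_zero_or_pos t with rfl | ht
  · simp [modifiedLaguerre_zero]
  rw [← integral_laguerreFunPi_smul_kernelOp hβ (NNReal.coe_pos.2 ht) hf]
  refine integral_congr_ae ?_
  filter_upwards [modifiedLaguerre_ae_eq hβ ht f] with x hx
  rw [hx]

/-- The spectral partial sums of f are the Laguerre partial sums of T_t f, because T_t multiplies
each coefficient by its exponential. -/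
theorem tendsto_modifiedSpectralPartialSum (t : ℝ≥0) {f : (Fin d → ℝ) → 𝕜}
    (hf : MemLp f 2 (orthantVolume d)) :
    Tendsto (fun N => eLpNorm (modifiedLaguerre α j t f - modifiedSpectralPartialSum α j t f N)
        2 (orthantVolume d)) atTop (𝓝 0) := by
  have h := tendsto_eLpNorm_sub_laguerre_sum hβ (memLp_modifiedLaguerre hβ t one_le_two hf)
  refine h.congr fun N => ?_
  congr 2
  funext x
  rw [sum_multiIndexLT, modifiedSpectralPartialSum]
  refine Finset.sum_congr rfl fun n _ => ?_
  rw [Finset.smul_sum]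
  refine Finset.sum_congr rfl fun k hk => ?_
  rw [integral_laguerreFunPi_smul_modifiedLaguerre hβ t
    (mem_LOneAddLInfty_of_memLp one_le_two hf), (Finset.mem_piAntidiag.1 hk).1, smul_comm]

omit hβ in
theorem HilbertBasis.norm_sq_eq_tsum {ι E : Type*} [NormedAddCommGroup E] [InnerProductSpace 𝕜 E]
    (b : HilbertBasis ι 𝕜 E) (x : E) : ‖x‖ ^ 2 = ∑' i, ‖b.repr x i‖ ^ 2 := by
  have := lp.norm_rpow_eq_tsum (p := 2) (by norm_num) (b.repr x)
  rw [LinearIsometryEquiv.norm_map] at this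
  simpa using this

omit hβ in
theorem HilbertBasis.summable_norm_sq {ι E : Type*} [NormedAddCommGroup E]
    [InnerProductSpace 𝕜 E] (b : HilbertBasis ι 𝕜 E) (x : E) :
    Summable fun i => ‖b.repr x i‖ ^ 2 := by
  have := (lp.memℓp (b.repr x)).summable (by norm_num)
  simpa using this

omit hβ in
theorem laguerreEigenvalue_nonneg {β : Fin d → ℝ} (hβ : ∀ i, 0 ≤ β i) (n : ℕ) :
    0 ≤ laguerreEigenvalue β n := by
  have := Finset.sum_nonneg fun i (_ : i ∈ Finset.univ) => hβ i
  rw [laguerreEigenvalue]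
  positivity

/-- Strong continuity at zero. -/
theorem tendsto_eLpNorm_modifiedLaguerre_sub {f : (Fin d → ℝ) → 𝕜}
    (hf : MemLp f 2 (orthantVolume d)) :
    Tendsto (fun t : ℝ≥0 => eLpNorm (modifiedLaguerre α j t f - f) 2 (orthantVolume d))
      (𝓝[>] 0) (𝓝 0) := by
  set b := laguerreBasis 𝕜 hβ
  set κ : (Fin d → ℕ) → ℝ := fun k => laguerreEigenvalue (shiftOrder α j) (∑ i, k i) + 1 / 2
  have hκ : ∀ k, 0 ≤ κ k := fun k => by
    have := laguerreEigenvalue_nonneg hβ (∑ i, k i)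
    positivity
  have hT : ∀ t, MemLp (modifiedLaguerre α j t f) 2 (orthantVolume d) := fun t =>
    memLp_modifiedLaguerre hβ t one_le_two hf
  set F : ℝ≥0 → Lp 𝕜 2 (orthantVolume d) := fun t => (hT t).toLp - hf.toLp with hF
  have hrepr : ∀ t k, ‖b.repr (F t) k‖ ^ 2 =
      (Real.exp (-(t : ℝ) * κ k) - 1) ^ 2 * ‖b.repr (hf.toLp f) k‖ ^ 2 := by
    intro t k
    have e : b.repr (F t) k = (Real.exp (-(t : ℝ) * κ k) - 1) • b.repr (hf.toLp f) k := by
      simp only [hF, map_sub]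
      rw [lp.coeFn_sub, Pi.sub_apply, laguerreBasis_repr_toLp, laguerreBasis_repr_toLp,
        integral_laguerreFunPi_smul_modifiedLaguerre hβ t
          (mem_LOneAddLInfty_of_memLp one_le_two hf), sub_smul, one_smul]
    rw [e, norm_smul, mul_pow, Real.norm_eq_abs, sq_abs]
  have hsum := b.summable_norm_sq (hf.toLp f)
  have hlim : Tendsto (fun t : ℝ≥0 => ∑' k, ‖b.repr (F t) k‖ ^ 2) (𝓝[>] 0)
      (𝓝 (∑' _ : Fin d → ℕ, (0 : ℝ))) := by
    -- By Parseval ‖T_t f - f‖² is a series with factors (e^(-tκ) - 1)² in [0, 1], dominated by the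
    -- squared coefficients of f.
    refine tendsto_tsum_of_dominated_convergence hsum (fun k => ?_) (Eventually.of_forall
      fun t k => ?_)
    · simp only [hrepr]
      have hc : Continuous fun t : ℝ≥0 => (Real.exp (-(t : ℝ) * κ k) - 1) ^ 2 *
          ‖b.repr (hf.toLp f) k‖ ^ 2 := by fun_prop
      have := (hc.tendsto 0).mono_left (nhdsWithin_le_nhds (s := Set.Ioi 0))
      simpa using this
    · rw [hrepr, Real.norm_of_nonneg (by positivity)]
      refine mul_le_of_le_one_left (by positivity) ?_
      have h1 : Real.exp (-(t : ℝ) * κ k) ≤ 1 := Real.exp_le_one_iff.2 (by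
        have := mul_nonneg t.2 (hκ k)
        simp only [NNReal.val_eq_coe] at this
        linarith)
      have h0 := Real.exp_pos (-(t : ℝ) * κ k)
      rw [sq_le_one_iff_abs_le_one, abs_le]
      constructor <;> linarith
  rw [tsum_zero] at hlim
  have hnorm : Tendsto (fun t => ‖F t‖ ^ 2) (𝓝[>] 0) (𝓝 0) := by
    simpa only [b.norm_sq_eq_tsum] using hlim
  have hnorm' : Tendsto (fun t => ‖F t‖) (𝓝[>] 0) (𝓝 0) := by
    have := hnorm.sqrt
    simpa [Real.sqrt_sq] using this
  have h3 := (tendsto_zero_iff_norm_tendsto_zero.2 hnorm').enorm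
  rw [enorm_zero] at h3
  refine h3.congr fun t => ?_
  simp only [hF]
  rw [← MemLp.toLp_sub, Lp.enorm_toLp]

theorem modifiedLaguerre_one_apply {t : ℝ≥0} (ht : 0 < t) {x : Fin d → ℝ}
    (hx : x ∈ posOrthant d) : modifiedLaguerre α j t (fun _ => (1 : 𝕜)) x =
      ((∫ y, modifiedHeatKernel (shiftOrder α j) t x y ∂(orthantVolume d) : ℝ) : 𝕜) := by
  have h := kernelOp_ofReal (𝕜 := 𝕜) (μ := orthantVolume d)
    (modifiedHeatKernel (shiftOrder α j) t) (fun _ => 1) x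
  simp only [RCLike.ofReal_one] at h
  rw [modifiedLaguerre_apply hβ ht _ hx, h]
  simp [kernelOp]

theorem isSymmetricDiffusionSemigroup_modifiedLaguerre :
    IsSymmetricDiffusionSemigroup (orthantVolume d) (LOneAddLInfty 𝕜 (orthantVolume d))
      (modifiedLaguerre α j) where
  measurable_of_mem f hf := aestronglyMeasurable_of_mem_LOneAddLInfty hf
  mem_of_memLp p hp f hf := mem_LOneAddLInfty_of_memLp hp hf
  measurable_map t f hf := by
    have hfm := aestronglyMeasurable_of_mem_LOneAddLInfty hf
    rcases eq_zero_or_pos t with rfl | ht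
    · rwa [modifiedLaguerre_zero]
    obtain ⟨Φ, hΦ⟩ := exists_isDominatedKernel_modifiedHeatKernel hβ (NNReal.coe_pos.2 ht)
    exact (hΦ.aestronglyMeasurable_kernelOp hfm).congr (modifiedLaguerre_ae_eq hβ ht f).symm
  congr t f _ g _ hfg := by
    rcases eq_zero_or_pos t with rfl | ht
    · simpa only [modifiedLaguerre_zero] using hfg
    filter_upwards [modifiedLaguerre_ae_eq hβ ht f, modifiedLaguerre_ae_eq hβ ht g] with x h1 h2
    rw [h1, h2, kernelOp_congr _ hfg]
  map_add t f hf g hg := by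
    rcases eq_zero_or_pos t with rfl | ht
    · simp only [modifiedLaguerre_zero]
      rfl
    obtain ⟨Φ, hΦ⟩ := exists_isDominatedKernel_modifiedHeatKernel hβ (NNReal.coe_pos.2 ht)
    filter_upwards [modifiedLaguerre_ae_eq hβ ht f, modifiedLaguerre_ae_eq hβ ht g,
      modifiedLaguerre_ae_eq hβ ht (f + g)] with x h1 h2 h3
    rw [h3, hΦ.kernelOp_add hf hg, Pi.add_apply, Pi.add_apply, h1, h2]
  map_smul t c f _ := by
    rcases eq_zero_or_pos t with rfl | ht
    · simp only [modifiedLaguerre_zero]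
      rfl
    filter_upwards [modifiedLaguerre_ae_eq hβ ht f, modifiedLaguerre_ae_eq hβ ht (c • f)]
      with x h1 h2
    rw [h2, kernelOp_smul, Pi.smul_apply, Pi.smul_apply, h1]
  zero f _ := by rw [modifiedLaguerre_zero]
  memLp p hp t f hf := memLp_modifiedLaguerre hβ t hp hf
  contraction p hp t := by
    rcases eq_zero_or_pos t with rfl | ht
    · refine iSup_le fun f => ?_
      rw [modifiedLaguerre_zero]
      exact f.2.2
    · refine (lpOpNorm_modifiedLaguerre_le hβ ht hp).trans ?_
      rw [← ENNReal.ofReal_one]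
      exact ENNReal.ofReal_le_ofReal (modifiedNormBound_lt_one d (NNReal.coe_pos.2 ht)).le
  semigroup p hp s t f hf := by
    rcases eq_zero_or_pos s with rfl | hs
    · rw [zero_add, modifiedLaguerre_zero]
    rcases eq_zero_or_pos t with rfl | ht
    · rw [add_zero, modifiedLaguerre_zero]
    filter_upwards [modifiedLaguerre_ae_eq hβ (add_pos hs ht) f,
      modifiedLaguerre_ae_eq hβ hs (modifiedLaguerre α j t f), ae_mem_posOrthant d] with x h1 h2 hx
    rw [h1, h2, kernelOp_congr _ (modifiedLaguerre_ae_eq hβ ht f), NNReal.coe_add,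
      kernelOp_modifiedHeatKernel_add hβ (NNReal.coe_pos.2 hs) (NNReal.coe_pos.2 ht)
        (mem_LOneAddLInfty_of_memLp hp hf) hx]
  selfAdjoint t f g hf hg := by
    rcases eq_zero_or_pos t with rfl | ht
    · simp only [modifiedLaguerre_zero]
    obtain ⟨Φ, hΦ⟩ := exists_isDominatedKernel_modifiedHeatKernel hβ (NNReal.coe_pos.2 ht)
    have h := hΦ.integral_inner_kernelOp (mem_LOneAddLInfty_of_memLp one_le_two hf)
      (mem_LOneAddLInfty_of_memLp one_le_two hg)
    refine Eq.trans (integral_congr_ae ?_) (h.trans (integral_congr_ae ?_))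
    · filter_upwards [modifiedLaguerre_ae_eq hβ ht f] with x hx
      rw [hx]
    · filter_upwards [modifiedLaguerre_ae_eq hβ ht g] with x hx
      rw [hx]
  tendsto f hf := tendsto_eLpNorm_modifiedLaguerre_sub hβ hf

theorem isSubmarkovian_modifiedLaguerre :
    IsSubmarkovian (orthantVolume d) (LOneAddLInfty 𝕜 (orthantVolume d))
      (modifiedLaguerre α j) := by
  refine ⟨isSymmetricDiffusionSemigroup_modifiedLaguerre hβ, fun t f _ h0 => ?_, fun t => ?_⟩
  · rcases eq_zero_or_pos t with rfl | ht
    · rwa [modifiedLaguerre_zero]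
    obtain ⟨Φ, hΦ⟩ := exists_isDominatedKernel_modifiedHeatKernel hβ (NNReal.coe_pos.2 ht)
    filter_upwards [modifiedLaguerre_ae_eq hβ ht f] with x hx
    rw [hx]
    exact hΦ.kernelOp_nonneg h0 x
  · rcases eq_zero_or_pos t with rfl | ht
    · rw [modifiedLaguerre_zero]
      exact ae_of_all _ fun _ => le_rfl
    filter_upwards [ae_mem_posOrthant d] with x hx
    rw [modifiedLaguerre_one_apply hβ ht hx, ← RCLike.ofReal_one, RCLike.ofReal_le_ofReal]
    exact (integral_modifiedHeatKernel_le hβ (NNReal.coe_pos.2 ht) x).trans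
      (modifiedNormBound_lt_one d (NNReal.coe_pos.2 ht)).le

/-- At t = 1 the row integral is strictly below 1 at every point; since the orthant has positive
measure, the almost-everywhere identity can be tested at one of them. -/
theorem not_isMarkovian_modifiedLaguerre :
    ¬ IsMarkovian (orthantVolume d) (LOneAddLInfty 𝕜 (orthantVolume d))
      (modifiedLaguerre (𝕜 := 𝕜) α j) := by
  rintro ⟨-, -, h⟩
  have hvol : orthantVolume d ≠ 0 := by
    rw [orthantVolume, Ne, Measure.restrict_eq_zero]
    have hne : (posOrthant d).Nonempty := ⟨fun _ => 1, fun _ => one_pos⟩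
    refine (IsOpen.measure_pos volume ?_ hne).ne'
    rw [posOrthant_eq_pi]
    exact isOpen_set_pi Set.finite_univ fun _ _ => isOpen_Ioi
  have : NeBot (ae (orthantVolume d)) := ae_neBot.2 hvol
  obtain ⟨x, hx1, hx⟩ := ((h 1).and (ae_mem_posOrthant d)).exists
  rw [modifiedLaguerre_one_apply hβ one_pos hx, ← RCLike.ofReal_one, RCLike.ofReal_inj] at hx1
  have h1 := integral_modifiedHeatKernel_le hβ one_pos x
  have h2 := modifiedNormBound_lt_one d one_pos
  rw [NNReal.coe_one] at hx1
  linarith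

end Semigroup

theorem mainTheorem5 {𝕜 : Type*} [RCLike 𝕜] {d : ℕ} (j : Fin d) (α : Fin d → ℝ)
    (hj : -1 ≤ α j) (hi : ∀ i, i ≠ j → 0 ≤ α i) :
    -- the series of the kernel converges, and so do the integrals that define the operators
    (∀ t : ℝ≥0, 0 < t → ∀ x ∈ posOrthant d, ∀ y ∈ posOrthant d,
      Summable (laguerreKernelTerm (shiftOrder α j) t x y)) ∧
    (∀ t : ℝ≥0, 0 < t → ∀ x ∈ posOrthant d, ∀ f ∈ LOneAddLInfty 𝕜 (orthantVolume d),
      Integrable (fun y => laguerreKernel (shiftOrder α j) t x y • f y) (orthantVolume d)) ∧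
    -- on `L²` the operators are those of the spectrally defined semigroup
    (∀ t : ℝ≥0, ∀ f : (Fin d → ℝ) → 𝕜, MemLp f 2 (orthantVolume d) →
      Tendsto (fun N => eLpNorm (modifiedLaguerre α j t f - modifiedSpectralPartialSum α j t f N)
        2 (orthantVolume d)) atTop (𝓝 0)) ∧
    IsSubmarkovian (orthantVolume d) (LOneAddLInfty 𝕜 (orthantVolume d))
      (modifiedLaguerre α j) ∧
    ¬ IsMarkovian (orthantVolume d) (LOneAddLInfty 𝕜 (orthantVolume d))
      (modifiedLaguerre (𝕜 := 𝕜) α j) ∧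
    (∀ p : ℝ≥0∞, 1 ≤ p → ∀ t : ℝ≥0, 0 < t →
      lpOpNorm (orthantVolume d) p (modifiedLaguerre (𝕜 := 𝕜) α j t) ≤
        ENNReal.ofReal (Real.exp (-(t : ℝ) / 2) * (Real.cosh ((t : ℝ) / 2) ^ d)⁻¹)) := by
  have hβ := shiftOrder_nonneg hj hi
  refine ⟨fun t ht x hx y hy => summable_laguerreKernelTerm hβ (NNReal.coe_pos.2 ht) hx hy,
    fun t ht x hx f hf => ?_,
    fun t f hf => tendsto_modifiedSpectralPartialSum hβ t hf,
    isSubmarkovian_modifiedLaguerre hβ, not_isMarkovian_modifiedLaguerre hβ,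
    fun p hp t ht => lpOpNorm_modifiedLaguerre_le hβ ht hp⟩
  obtain ⟨Φ, hΦ⟩ := exists_isDominatedKernel_laguerreHeatKernel hβ (NNReal.coe_pos.2 ht)
  refine (hΦ.integrable_smul hf x).congr ?_
  filter_upwards [laguerreKernel_ae_eq hβ (NNReal.coe_pos.2 ht) hx] with y hy
  rw [hy]
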